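/- **Setting.** Let $\mathcal S$ be a compact, second countable topological space with a finite Borel measure $ds$ (for instance a compact subset of $\mathbb R^n$ with Lebesgue measure), let $\mathcal A\subset\mathbb R^m$ be compact with Lebesgue measure $da$, and consider the Markov decision process with transition density $p(s'\mid s,a)$, initial density $d_0(s)$, deterministic reward $r(s,a)$ and discount factor $\gamma\in[0,1)$. For a policy with density $\pi(a\mid s)$ let $\mathcal H(\pi(\cdot\mid s))=-\int_{\mathcal A}\pi(a\mid s)\log\pi(a\mid s)\,da$, and for $\alpha\in\mathbb R$ put $$J(\pi)=\mathbb E_\pi\Big[\sum_{t\ge0}\gamma^t\big(r(S_t,A_t)+\alpha\mathcal H(\pi(\cdot\mid S_t))\big)\Big],$$ $$Q_\pi(s,a)=\mathbb E_\pi\Big[\sum_{t\ge0}\gamma^t\big(r(S_t,A_t)+\alpha\gamma\mathcal H(\pi(\cdot\mid S_{t+1}))\big)\,\Big|\,S_0=s,A_0=a\Big],$$ $$d_\pi(B)=\sum_{t\ge0}\gamma^t\,\mathbb P_\pi(S_t\in B)\quad\text{(the unnormalized discounted occupancy measure)},$$ where $S_0\sim d_0$ (in $J$ and $d_\pi$),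 $A_t\sim\pi(\cdot\mid S_t)$ and $S_{t+1}\sim p(\cdot\mid S_t,A_t)$. For $\theta\in\mathbb R^d$ consider the mixture policy $$\pi^m_\theta(a\mid s)=\sum_{k=1}^N\pi^w_\theta(k\mid s)\,\pi^c_\theta(a\mid s,k),$$ where $\pi^w_\theta(\cdot\mid s)$ is a probability vector and each $\pi^c_\theta(\cdot\mid s,k)$ is a probability density on $\mathcal A$. The components are reparameterized: there are a set $\Xi\subset\mathbb R^l$, a probability density $p(\varepsilon)$ on $\Xi$ with respect to Lebesgue measure, and bijections $f_\theta(\cdot\,;s,k):\Xi\to\mathcal A$ such that $f_\theta(\varepsilon;s,k)$ has law $\pi^c_\theta(\cdot\mid s,k)$ when $\varepsilon\sim p$. **Assumptions.** The functions $p(s'\mid s,a)$, $d_0(s)$, $r(s,a)$, $f_\theta(\varepsilon;s,k)$, $f_\theta^{-1}(a;s,k)$, $\pi^w_\theta(k\mid s)$, $\pi^c_\theta(a\mid s,k)$, $p(\varepsilon)$ are jointly continuous in $s,a,s',\theta,\varepsilon$. The first derivatives of $p(s'\mid s,a)$, $r(s,a)$ and $\pi^c_\theta(a\mid s,k)$ in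 $a$ (taken within $\mathcal A$), and of $f_\theta(\varepsilon;s,k)$, $\pi^w_\theta(k\mid s)$ and $\pi^c_\theta(a\mid s,k)$ in $\theta$, exist and are jointly continuous in all variables. Finally $\pi^m_\theta(a\mid s)>0$ for all $\theta$, $s\in\mathcal S$, $a\in\mathcal A$, so that $\log\pi^m_\theta(a\mid s)$ is defined. **Theorem (Entropy-Regularized Marginalized-Reparameterization Policy Gradient Theorem).** Fix $\theta\in\mathbb R^d$. For all $s\in\mathcal S$ and $\varepsilon\in\Xi$ the function $$\theta'\mapsto\sum_{k=1}^N\pi^w_{\theta'}(k\mid s)\Big(Q_{\pi^m_\theta}(s,f_{\theta'}(\varepsilon;s,k))-\alpha\log\pi^m_{\theta'}(f_{\theta'}(\varepsilon;s,k)\mid s)\Big)$$ (in which the policy defining $Q$ is held fixed at $\pi^m_\theta$) is differentiable at $\theta'=\theta$, its gradient there is integrable with respect to $d_{\pi^m_\theta}(ds)\otimes p(\varepsilon)\,d\varepsilon$, the function $\theta'\mapsto J(\pi^m_{\theta'})$ is differentiable at $\theta$, and $$\nabla_\theta J(\pi^m_\theta)=\mathbb E_{s\sim d_{\pi^m_\theta},\,\varepsilon\sim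 p}\Big[\nabla_{\theta'}\sum_{k=1}^N\pi^w_{\theta'}(k\mid s)\Big(Q_{\pi^m_\theta}(s,f_{\theta'}(\varepsilon;s,k))-\alpha\log\pi^m_{\theta'}(f_{\theta'}(\varepsilon;s,k)\mid s)\Big)\Big|_{\theta'=\theta}\Big],$$ where $\mathbb E_{s\sim d_\pi}$ denotes integration against the (unnormalized) measure $d_\pi$. -/

import Mathlib

open MeasureTheory ProbabilityTheory TopologicalSpace
open scoped ENNReal

noncomputable section

namespace MixturePG

/-- `ℝⁿ` with its Euclidean norm. -/
abbrev Eu (n : ℕ) : Type := EuclideanSpace ℝ (Fin n)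

/-- Lebesgue measure on a subset of `ℝⁿ`, viewed as a subtype. -/
def lebesgueOn {n : ℕ} (p : Eu n → Prop) : Measure (Subtype p) :=
  Measure.comap Subtype.val (volume : Measure (Eu n))

/-- Lebesgue measure on a compact action space `A ⊆ ℝᵐ`. -/
def actionMeasure {m : ℕ} (A : Compacts (Eu m)) : Measure A :=
  lebesgueOn fun a => a ∈ A

instance instFiniteActionMeasure {m : ℕ} (A : Compacts (Eu m)) :
    IsFiniteMeasure (actionMeasure A) where
  measure_univ_lt_top := by
    have h : actionMeasure A Set.univ = volume (A : Set (Eu m)) := by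
      have := comap_subtype_coe_apply A.isCompact.measurableSet
        (volume : Measure (Eu m)) Set.univ
      rw [Set.image_univ, Subtype.range_coe_subtype] at this
      exact this
    rw [h]
    exact A.isCompact.measure_lt_top

/-- Lebesgue measure on a noise space `Ξ ⊆ ℝˡ`. -/
def noiseVolume {l : ℕ} (Ξ : Set (Eu l)) : Measure Ξ :=
  lebesgueOn fun ε => ε ∈ Ξ

/-- A Markov decision process with state space `S` (with reference measure `μ`, written `ds` in
integrals), action space `A ⊆ ℝᵐ`, transition density `trans s a s' = p(s' | s, a)`, initial state
density `init = d₀`, deterministic reward `reward = r` and discount factor `disc = γ`. -/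
structure MDP (S : Type*) [MeasurableSpace S] (μ : Measure S) {m : ℕ} (A : Compacts (Eu m)) where
  trans : S → A → S → ℝ
  init : S → ℝ
  reward : S → A → ℝ
  disc : ℝ
  measurable_trans : Measurable fun x : (S × A) × S => trans x.1.1 x.1.2 x.2
  trans_nonneg : ∀ s a s', 0 ≤ trans s a s'
  lintegral_trans : ∀ s a, ∫⁻ s', ENNReal.ofReal (trans s a s') ∂μ = 1
  measurable_init : Measurable init
  init_nonneg : ∀ s, 0 ≤ init s
  lintegral_init : ∫⁻ s, ENNReal.ofReal (init s) ∂μ = 1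
  measurable_reward : Measurable fun x : S × A => reward x.1 x.2
  disc_nonneg : 0 ≤ disc
  disc_lt_one : disc < 1

/-- A stochastic policy, given by its density `dens s a = π(a | s)` with respect to Lebesgue
measure on the action space. -/
structure Policy (S : Type*) [MeasurableSpace S] {m : ℕ} (A : Compacts (Eu m)) where
  dens : S → A → ℝ
  measurable_dens : Measurable fun x : S × A => dens x.1 x.2
  dens_nonneg : ∀ s a, 0 ≤ dens s a
  lintegral_dens : ∀ s, ∫⁻ a, ENNReal.ofReal (dens s a) ∂(actionMeasure A) = 1

section Chain

variable {S : Type*} [MeasurableSpace S] {μ : Measure S} [IsFiniteMeasure μ]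
  {m : ℕ} {A : Compacts (Eu m)}

/-- The law `π(· | s)` on actions, as a kernel. -/
def Policy.kernel (π : Policy S A) : Kernel S A :=
  Kernel.withDensity (Kernel.const S (actionMeasure A)) fun s a => ENNReal.ofReal (π.dens s a)

instance Policy.instMarkovKernel (π : Policy S A) : IsMarkovKernel π.kernel where
  isProbabilityMeasure s := by
    refine ⟨?_⟩
    have h : Measurable (Function.uncurry fun (s : S) (a : A) => ENNReal.ofReal (π.dens s a)) :=
      π.measurable_dens.ennreal_ofReal
    rw [Policy.kernel, Kernel.withDensity_apply' _ h, Measure.restrict_univ, Kernel.const_apply]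
    exact π.lintegral_dens s

/-- Differential entropy `H(π(· | s)) = - ∫ π(a | s) log π(a | s) da`. -/
def Policy.entropy (π : Policy S A) (s : S) : ℝ :=
  -∫ a, π.dens s a * Real.log (π.dens s a) ∂(actionMeasure A)

/-- The law `p(· | s, a)` of the next state, as a kernel. -/
def MDP.transKernel (M : MDP S μ A) : Kernel (S × A) S :=
  Kernel.withDensity (Kernel.const (S × A) μ) fun x s' => ENNReal.ofReal (M.trans x.1 x.2 s')

instance MDP.instMarkovTransKernel (M : MDP S μ A) : IsMarkovKernel M.transKernel where
  isProbabilityMeasure x := by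
    refine ⟨?_⟩
    have h : Measurable
        (Function.uncurry fun (x : S × A) (s' : S) => ENNReal.ofReal (M.trans x.1 x.2 s')) :=
      M.measurable_trans.ennreal_ofReal
    rw [MDP.transKernel, Kernel.withDensity_apply' _ h, Measure.restrict_univ, Kernel.const_apply]
    exact M.lintegral_trans x.1 x.2

/-- The law of the initial state. -/
def MDP.initMeasure (M : MDP S μ A) : Measure S :=
  μ.withDensity fun s => ENNReal.ofReal (M.init s)

instance MDP.instProbInitMeasure (M : MDP S μ A) : IsProbabilityMeasure M.initMeasure := by
  refine ⟨?_⟩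
  rw [MDP.initMeasure, withDensity_apply _ MeasurableSet.univ, Measure.restrict_univ]
  exact M.lintegral_init

/-- One step of the chain of state-action pairs:
`S_{t+1} ∼ p(· | S_t, A_t)` and then `A_{t+1} ∼ π(· | S_{t+1})`. -/
def MDP.step (M : MDP S μ A) (π : Policy S A) : Kernel (S × A) (S × A) :=
  M.transKernel ⊗ₖ (π.kernel.prodMkLeft (S × A))

instance MDP.instMarkovStep (M : MDP S μ A) (π : Policy S A) : IsMarkovKernel (M.step π) := by
  unfold MDP.step
  infer_instance

/-- The conditional law of `(S_{n+1}, A_{n+1})` given the history up to time `n`. -/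
def MDP.histStep (M : MDP S μ A) (π : Policy S A) (n : ℕ) :
    Kernel (Finset.Iic n → S × A) (S × A) :=
  (M.step π).comap (fun h => h ⟨n, Finset.mem_Iic.2 le_rfl⟩) (measurable_pi_apply _)

instance MDP.instMarkovHistStep (M : MDP S μ A) (π : Policy S A) (n : ℕ) :
    IsMarkovKernel (M.histStep π n) := by
  unfold MDP.histStep
  infer_instance

/-- The law of the whole trajectory `(S_t, A_t)_{t ≥ 0}` when the policy `π` is followed and
`(S_0, A_0)` has law `ρ`. -/
def MDP.pathMeasure (M : MDP S μ A) (π : Policy S A) (ρ : Measure (S × A)) :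
    Measure (ℕ → S × A) :=
  Kernel.trajMeasure (X := fun _ => S × A) ρ (M.histStep π)

/-- The law `P_π` of the trajectory with `S_0 ∼ d₀` and `A_0 ∼ π(· | S_0)`. -/
def MDP.law (M : MDP S μ A) (π : Policy S A) : Measure (ℕ → S × A) :=
  M.pathMeasure π (M.initMeasure ⊗ₘ π.kernel)

/-- The entropy-regularized objective
`J(π) = E_π[∑ₜ γᵗ (r(S_t, A_t) + α H(π(· | S_t)))]`. -/
def MDP.objective (M : MDP S μ A) (α : ℝ) (π : Policy S A) : ℝ :=
  ∫ ω, ∑' t : ℕ, M.disc ^ t *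
    (M.reward (ω t).1 (ω t).2 + α * π.entropy (ω t).1) ∂(M.law π)

/-- The soft action-value function
`Q_π(s, a) = E_π[∑ₜ γᵗ (r(S_t, A_t) + α γ H(π(· | S_{t+1}))) | S_0 = s, A_0 = a]`. -/
def MDP.softQ (M : MDP S μ A) (α : ℝ) (π : Policy S A) (s : S) (a : A) : ℝ :=
  ∫ ω, ∑' t : ℕ, M.disc ^ t *
    (M.reward (ω t).1 (ω t).2 + α * M.disc * π.entropy (ω (t + 1)).1)
      ∂(M.pathMeasure π (Measure.dirac (s, a)))

/-- The (unnormalized) discounted occupancy measure `d_π(B) = ∑ₜ γᵗ P_π(S_t ∈ B)`. -/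
def MDP.occupancy (M : MDP S μ A) (π : Policy S A) : Measure S :=
  Measure.sum fun t : ℕ => ENNReal.ofReal (M.disc ^ t) • (M.law π).map fun ω => (ω t).1

end Chain

/-- A mixture policy with `N` components, parameterized by `θ ∈ ℝᵈ`, whose components are
reparameterized through a noise variable `ε ∈ Ξ ⊆ ℝˡ`:
* `weight θ s k = π^w_θ(k | s)`, the weighting policy;
* `comp θ s k a = π^c_θ(a | s, k)`, the density of the `k`-th component policy;
* `noise ε = p(ε)`, the density of the noise;
* `repar θ s k ε = f_θ(ε; s, k)`, an invertible map from the noise space to the action space, with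
  inverse `(repar θ s k).symm a = f_θ⁻¹(a; s, k)`.
The field `map_repar` says that `f_θ(ε; s, k)` has law `π^c_θ(· | s, k)` when `ε ∼ p`. -/
structure MixturePolicy (S : Type*) [MeasurableSpace S] {m : ℕ} (A : Compacts (Eu m))
    {l : ℕ} (Ξ : Set (Eu l)) (d N : ℕ) where
  weight : Eu d → S → Fin N → ℝ
  comp : Eu d → S → Fin N → A → ℝ
  noise : Ξ → ℝ
  repar : Eu d → S → Fin N → Ξ ≃ A
  measurable_weight : ∀ θ k, Measurable fun s => weight θ s k
  weight_nonneg : ∀ θ s k, 0 ≤ weight θ s k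
  sum_weight : ∀ θ s, ∑ k, weight θ s k = 1
  measurable_comp : ∀ θ k, Measurable fun x : S × A => comp θ x.1 k x.2
  comp_nonneg : ∀ θ s k a, 0 ≤ comp θ s k a
  lintegral_comp : ∀ θ s k, ∫⁻ a, ENNReal.ofReal (comp θ s k a) ∂(actionMeasure A) = 1
  measurable_noise : Measurable noise
  noise_nonneg : ∀ ε, 0 ≤ noise ε
  lintegral_noise : ∫⁻ ε, ENNReal.ofReal (noise ε) ∂(noiseVolume Ξ) = 1
  map_repar : ∀ θ s k,
    Measure.map (repar θ s k) ((noiseVolume Ξ).withDensity fun ε => ENNReal.ofReal (noise ε))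
      = (actionMeasure A).withDensity fun a => ENNReal.ofReal (comp θ s k a)

section Mixture

variable {S : Type*} [MeasurableSpace S] {m : ℕ} {A : Compacts (Eu m)} {l : ℕ} {Ξ : Set (Eu l)}
  {d N : ℕ}

/-- The law of the noise `ε ∼ p`. -/
def MixturePolicy.noiseMeasure (P : MixturePolicy S A Ξ d N) : Measure Ξ :=
  (noiseVolume Ξ).withDensity fun ε => ENNReal.ofReal (P.noise ε)

/-- The mixture policy `π^m_θ(a | s) = ∑ₖ π^w_θ(k | s) π^c_θ(a | s, k)`. -/
def MixturePolicy.policy (P : MixturePolicy S A Ξ d N) (θ : Eu d) : Policy S A where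
  dens s a := ∑ k, P.weight θ s k * P.comp θ s k a
  measurable_dens := Finset.measurable_sum _ fun k _ =>
    ((P.measurable_weight θ k).comp measurable_fst).mul (P.measurable_comp θ k)
  dens_nonneg s a := Finset.sum_nonneg fun k _ =>
    mul_nonneg (P.weight_nonneg θ s k) (P.comp_nonneg θ s k a)
  lintegral_dens s := by
    have hm : ∀ k, Measurable fun a : A => ENNReal.ofReal (P.comp θ s k a) := fun k =>
      ((P.measurable_comp θ k).comp measurable_prodMk_left).ennreal_ofReal
    simp_rw [ENNReal.ofReal_sum_of_nonneg fun k _ =>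
      mul_nonneg (P.weight_nonneg θ s k) (P.comp_nonneg θ s k _),
      ENNReal.ofReal_mul (P.weight_nonneg θ s _)]
    rw [lintegral_finsetSum _ fun k _ => (hm k).const_mul _]
    simp_rw [lintegral_const_mul _ (hm _), P.lintegral_comp, mul_one]
    rw [← ENNReal.ofReal_sum_of_nonneg fun k _ => P.weight_nonneg θ s k, P.sum_weight,
      ENNReal.ofReal_one]

end Mixture

/-- `g x θ` has a derivative in the parameter `θ ∈ ℝᵈ` which is jointly continuous in `(x, θ)`. -/
def HasContDerivParam {X F : Type*} [TopologicalSpace X] [NormedAddCommGroup F] [NormedSpace ℝ F]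
    {d : ℕ} (g : X → Eu d → F) : Prop :=
  ∃ D : X → Eu d → (Eu d →L[ℝ] F), (Continuous fun y : X × Eu d => D y.1 y.2) ∧
    ∀ x θ, HasFDerivAt (g x) (D x θ) θ

/-- `g x a` has a derivative in the action `a ∈ A ⊆ ℝᵐ`, taken within the compact set `A`, which is
jointly continuous in `(x, a)`. Here `G` is any extension of `g` off `A`; derivatives within `A` do
not depend on it. -/
def HasContDerivAction {X : Type*} [TopologicalSpace X] {m : ℕ} {A : Compacts (Eu m)}
    (g : X → A → ℝ) : Prop :=
  ∃ (G : X → Eu m → ℝ) (D : X → A → (Eu m →L[ℝ] ℝ)),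
    (∀ x (a : A), G x a = g x a) ∧ (Continuous fun y : X × A => D y.1 y.2) ∧
    ∀ x (a : A), HasFDerivWithinAt (G x) (D x a) (A : Set (Eu m)) a

/-- Regularity of the environment: `p(s' | s, a)`, `d₀(s)`, `r(s, a)` are continuous, and so are the
derivatives of `p` and `r` in the action. -/
structure MDP.Regular {S : Type*} [TopologicalSpace S] [MeasurableSpace S] {μ : Measure S} {m : ℕ}
    {A : Compacts (Eu m)} (M : MDP S μ A) : Prop where
  continuous_trans : Continuous fun x : S × A × S => M.trans x.1 x.2.1 x.2.2
  continuous_init : Continuous M.init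
  continuous_reward : Continuous fun x : S × A => M.reward x.1 x.2
  deriv_trans : HasContDerivAction fun (x : S × S) (a : A) => M.trans x.1 a x.2
  deriv_reward : HasContDerivAction M.reward

/-- Regularity of the policy class: `f_θ(ε; s, k)`, `f_θ⁻¹(a; s, k)`, `π^w_θ(k | s)`,
`π^c_θ(a | s, k)`, `p(ε)` are jointly continuous, and so are the derivatives of `f`, `π^w`, `π^c` in
`θ` and of `π^c` in the action. -/
structure MixturePolicy.Regular {S : Type*} [TopologicalSpace S] [MeasurableSpace S] {m : ℕ}
    {A : Compacts (Eu m)} {l : ℕ} {Ξ : Set (Eu l)} {d N : ℕ} (P : MixturePolicy S A Ξ d N) :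
    Prop where
  continuous_repar : ∀ k, Continuous fun x : Eu d × S × Ξ => P.repar x.1 x.2.1 k x.2.2
  continuous_repar_symm : ∀ k,
    Continuous fun x : Eu d × S × A => (P.repar x.1 x.2.1 k).symm x.2.2
  continuous_weight : ∀ k, Continuous fun x : Eu d × S => P.weight x.1 x.2 k
  continuous_comp : ∀ k, Continuous fun x : Eu d × S × A => P.comp x.1 x.2.1 k x.2.2
  continuous_noise : Continuous P.noise
  deriv_repar : ∀ k, HasContDerivParam fun (x : S × Ξ) θ => (P.repar θ x.1 k x.2 : Eu m)
  deriv_weight : ∀ k, HasContDerivParam fun (s : S) θ => P.weight θ s k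
  deriv_comp_param : ∀ k, HasContDerivParam fun (x : S × A) θ => P.comp θ x.1 k x.2
  deriv_comp_action : ∀ k,
    HasContDerivAction fun (x : Eu d × S) (a : A) => P.comp x.1 x.2 k a

/-- The marginalized integrand
`∑ₖ π^w_θ'(k | s) (Q_{π^m_θ}(s, f_θ'(ε; s, k)) - α log π^m_θ'(f_θ'(ε; s, k) | s))`.
The policy inside the action-value function is the current one, with parameter `θ`; everything else
depends on the variable `θ'` in which the gradient is taken (at `θ' = θ`). -/
def mrpIntegrand {S : Type*} [MeasurableSpace S] {μ : Measure S} [IsFiniteMeasure μ] {m : ℕ}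
    {A : Compacts (Eu m)} {l : ℕ} {Ξ : Set (Eu l)} {d N : ℕ} (M : MDP S μ A)
    (P : MixturePolicy S A Ξ d N) (α : ℝ) (θ : Eu d) (s : S) (ε : Ξ) (θ' : Eu d) : ℝ :=
  ∑ k, P.weight θ' s k *
    (M.softQ α (P.policy θ) s (P.repar θ' s k ε)
      - α * Real.log ((P.policy θ').dens s (P.repar θ' s k ε)))

end MixturePG

end

/-!
Write `V_θ` for the soft state value of the policy `π_θ`, `P_θ` for its state kernel, and `B_θ'` for
the value of choosing the first action by `π_θ'` and all later ones by `π_θ`. The difference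
`u = V_θ' - V_θ` solves `u - γ P_θ' u = B_θ' - V_θ`, whereas the occupancy measure is the resolvent
`∑ₜ γᵗ P_θᵗ` applied to the initial law, so that `J(θ') - J(θ) = ∫ (u - γ P_θ u) d(d_θ)`.
Both `u` and `P_θ' - P_θ` are `O(‖θ' - θ‖)`: exchanging `P_θ` for `P_θ'` therefore costs only
`O(‖θ' - θ‖²)`, and `∫ (B_θ' - V_θ) d(d_θ)` has the same gradient as `J` at `θ' = θ`, without any
derivative of the occupancy measure. Reparameterizing each mixture component turns `B_θ'(s)` into
`∫ mrpIntegrand dε`, which is differentiated under the integral sign; this is legitimate because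
`Ξ`, being homeomorphic to the action space, is compact.
-/

open Asymptotics
open scoped Topology

noncomputable section

namespace MixturePG

/-! ### Resolvents of Markov kernels -/

section AbsIntegral

variable {X : Type*} [MeasurableSpace X] {f : X → ℝ} {C : ℝ}

lemma abs_integral_le_mul_real_univ (hC : ∀ x, |f x| ≤ C) (ν : Measure X) [IsFiniteMeasure ν] :
    |∫ x, f x ∂ν| ≤ C * ν.real Set.univ :=
  norm_integral_le_of_norm_le_const (f := f) (.of_forall hC)

lemma abs_integral_le_of_abs_le (hC : ∀ x, |f x| ≤ C) (ν : Measure X) [IsProbabilityMeasure ν] :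
    |∫ x, f x ∂ν| ≤ C := by
  simpa using abs_integral_le_mul_real_univ hC ν

end AbsIntegral

lemma integral_comp_measure {X Y : Type*} [MeasurableSpace X] [MeasurableSpace Y] {ν : Measure X}
    [SFinite ν] {κ : Kernel X Y} [IsSFiniteKernel κ] {f : Y → ℝ} (hf : Integrable f (κ ∘ₘ ν)) :
    ∫ y, f y ∂(κ ∘ₘ ν) = ∫ x, ∫ y, f y ∂κ x ∂ν := by
  rw [Measure.comp_eq_comp_const_apply] at hf ⊢
  exact Kernel.integral_comp hf

/-- Bounded measurable real functions: the class on which the kernels below act. -/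
structure BddMeasurable {X : Type*} [MeasurableSpace X] (f : X → ℝ) : Prop where
  measurable : Measurable f
  bdd : ∃ C, ∀ x, |f x| ≤ C

namespace BddMeasurable

variable {X Y : Type*} [MeasurableSpace X] [MeasurableSpace Y] {f g : X → ℝ}

lemma exists_nonneg_bound (hf : BddMeasurable f) : ∃ C, 0 ≤ C ∧ ∀ x, |f x| ≤ C := by
  obtain ⟨C, hC⟩ := hf.bdd
  exact ⟨max C 0, le_max_right _ _, fun x => (hC x).trans (le_max_left _ _)⟩

lemma of_continuous [TopologicalSpace X] [CompactSpace X] [OpensMeasurableSpace X]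
    (hf : Continuous f) : BddMeasurable f := by
  obtain ⟨C, hC⟩ := isCompact_univ.exists_bound_of_continuousOn hf.continuousOn
  exact ⟨hf.measurable, C, fun x => hC x (Set.mem_univ x)⟩

lemma integrable (hf : BddMeasurable f) (ν : Measure X) [IsFiniteMeasure ν] : Integrable f ν := by
  obtain ⟨C, hC⟩ := hf.bdd
  exact Integrable.of_bound hf.measurable.aestronglyMeasurable C (.of_forall hC)

lemma add (hf : BddMeasurable f) (hg : BddMeasurable g) : BddMeasurable fun x => f x + g x := by
  obtain ⟨C, hC⟩ := hf.bdd
  obtain ⟨D, hD⟩ := hg.bdd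
  exact ⟨hf.measurable.add hg.measurable, C + D, fun x =>
    (abs_add_le _ _).trans (add_le_add (hC x) (hD x))⟩

lemma const_mul (hf : BddMeasurable f) (c : ℝ) : BddMeasurable fun x => c * f x := by
  obtain ⟨C, hC⟩ := hf.bdd
  refine ⟨hf.measurable.const_mul c, |c| * C, fun x => ?_⟩
  rw [abs_mul]
  exact mul_le_mul_of_nonneg_left (hC x) (abs_nonneg c)

lemma sub (hf : BddMeasurable f) (hg : BddMeasurable g) : BddMeasurable fun x => f x - g x := by
  simpa [sub_eq_add_neg] using hf.add (hg.const_mul (-1))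

lemma comp (hf : BddMeasurable f) {φ : Y → X} (hφ : Measurable φ) :
    BddMeasurable fun y => f (φ y) :=
  ⟨hf.measurable.comp hφ, hf.bdd.imp fun _ hC y => hC (φ y)⟩

lemma integral_kernel_prod_right {h : Y × X → ℝ} (hh : BddMeasurable h) (κ : Kernel Y X)
    [IsFiniteKernel κ] : BddMeasurable fun y => ∫ x, h (y, x) ∂κ y := by
  obtain ⟨C, hC0, hC⟩ := hh.exists_nonneg_bound
  refine ⟨(StronglyMeasurable.integral_kernel_prod_right'
    hh.measurable.stronglyMeasurable).measurable, C * κ.bound.toReal, fun y => ?_⟩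
  calc |∫ x, h (y, x) ∂κ y| ≤ C * (κ y).real Set.univ :=
        abs_integral_le_mul_real_univ (fun x => hC (y, x)) _
    _ ≤ C * κ.bound.toReal := mul_le_mul_of_nonneg_left
        (ENNReal.toReal_mono κ.bound_ne_top (κ.measure_le_bound y _)) hC0

lemma integral_kernel (hf : BddMeasurable f) (κ : Kernel Y X) [IsFiniteKernel κ] :
    BddMeasurable fun y => ∫ x, f x ∂κ y :=
  integral_kernel_prod_right (hf.comp measurable_snd) κ

end BddMeasurable

section Discounted

variable {X : Type*} [MeasurableSpace X] {γ C : ℝ} {f : ℕ → X → ℝ}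

lemma summable_discounted (hγ0 : 0 ≤ γ) (hγ1 : γ < 1) {a : ℕ → ℝ} (ha : ∀ t, |a t| ≤ C) :
    Summable fun t => γ ^ t * a t := by
  refine Summable.of_norm_bounded ((summable_geometric_of_lt_one hγ0 hγ1).mul_right C) fun t => ?_
  rw [Real.norm_eq_abs, abs_mul, abs_of_nonneg (pow_nonneg hγ0 t)]
  exact mul_le_mul_of_nonneg_left (ha t) (pow_nonneg hγ0 t)

lemma integral_discounted (hγ0 : 0 ≤ γ) (hγ1 : γ < 1) (hf : ∀ t, Measurable (f t))
    (hC : ∀ t x, |f t x| ≤ C) (ν : Measure X) [IsProbabilityMeasure ν] :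
    ∫ x, ∑' t, γ ^ t * f t x ∂ν = ∑' t, γ ^ t * ∫ x, f t x ∂ν := by
  have hb : ∀ t, BddMeasurable fun x => γ ^ t * f t x := fun t =>
    BddMeasurable.const_mul ⟨hf t, C, hC t⟩ _
  rw [← integral_tsum_of_summable_integral_norm (fun t => (hb t).integrable ν)]
  · simp_rw [integral_const_mul]
  · have hnorm : ∀ t, |∫ x, ‖f t x‖ ∂ν| ≤ C := fun t =>
      abs_integral_le_of_abs_le (fun x => (abs_norm (f t x)).trans_le (hC t x)) ν
    simpa only [norm_mul, norm_pow, Real.norm_of_nonneg hγ0, integral_const_mul]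
      using summable_discounted hγ0 hγ1 hnorm

end Discounted

section Resolvent

variable {X Y : Type*} [MeasurableSpace X] [MeasurableSpace Y]

instance isMarkovKernel_pow (κ : Kernel X X) [IsMarkovKernel κ] (t : ℕ) :
    IsMarkovKernel (κ ^ t) := by
  induction t with
  | zero => exact inferInstanceAs (IsMarkovKernel Kernel.id)
  | succ t ih => exact inferInstanceAs (IsMarkovKernel ((κ ^ t) ∘ₖ κ))

/-- The discounted potential kernel `∑ₜ γᵗ κᵗ = (1 - γ κ)⁻¹` of a kernel `κ`. -/
def resolvent (γ : ℝ) (κ : Kernel X X) : Kernel X X where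
  toFun x := Measure.sum fun t : ℕ => ENNReal.ofReal (γ ^ t) • (κ ^ t) x
  measurable' := Measure.measurable_of_measurable_coe _ fun s hs => by
    simp only [Measure.sum_apply _ hs, Measure.smul_apply, smul_eq_mul]
    exact Measurable.tsum fun t => ((κ ^ t).measurable_coe hs).const_mul _

lemma resolvent_comp (γ : ℝ) (κ : Kernel X X) (ρ : Measure X) :
    resolvent γ κ ∘ₘ ρ = Measure.sum fun t : ℕ => ENNReal.ofReal (γ ^ t) • (⇑(κ ^ t) ∘ₘ ρ) := by
  ext s hs
  simp only [Measure.bind_apply hs (Kernel.aemeasurable _), Measure.sum_apply _ hs,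
    Measure.smul_apply, smul_eq_mul]
  change ∫⁻ x, (Measure.sum fun t : ℕ => ENNReal.ofReal (γ ^ t) • (κ ^ t) x) s ∂ρ = _
  simp only [Measure.sum_apply _ hs, Measure.smul_apply, smul_eq_mul]
  rw [lintegral_tsum fun t => (((κ ^ t).measurable_coe hs).const_mul _).aemeasurable]
  exact tsum_congr fun t => lintegral_const_mul _ ((κ ^ t).measurable_coe hs)

lemma pow_comp_eq_comp_pow {κ : Kernel X X} {η : Kernel Y Y} {E : Kernel Y X}
    (h : κ ∘ₖ E = E ∘ₖ η) (t : ℕ) : (κ ^ t) ∘ₖ E = E ∘ₖ (η ^ t) := by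
  induction t with
  | zero => exact (Kernel.id_comp E).trans (Kernel.comp_id E).symm
  | succ t ih =>
    calc (κ ^ (t + 1)) ∘ₖ E = (κ ^ t) ∘ₖ (κ ∘ₖ E) := by
          rw [pow_succ, ← Kernel.comp_assoc]; rfl
      _ = E ∘ₖ (η ^ (t + 1)) := by
          rw [h, ← Kernel.comp_assoc, ih, Kernel.comp_assoc, pow_succ]; rfl

lemma resolvent_comp_comp {κ : Kernel X X} {η : Kernel Y Y} {E : Kernel Y X}
    (h : κ ∘ₖ E = E ∘ₖ η) (γ : ℝ) (ν : Measure Y) :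
    resolvent γ κ ∘ₘ (E ∘ₘ ν) = E ∘ₘ (resolvent γ η ∘ₘ ν) := by
  ext s hs
  simp only [resolvent_comp, Measure.comp_assoc, pow_comp_eq_comp_pow h]
  simp only [← Measure.comp_assoc, Measure.bind_apply hs (Kernel.aemeasurable _),
    Measure.sum_apply _ hs, Measure.smul_apply, smul_eq_mul, lintegral_sum_measure,
    lintegral_smul_measure]

variable {γ : ℝ} (hγ0 : 0 ≤ γ) (hγ1 : γ < 1) (κ : Kernel X X) [IsMarkovKernel κ]
include hγ0 hγ1

lemma resolvent_comp_univ (ρ : Measure X) [IsProbabilityMeasure ρ] :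
    (resolvent γ κ ∘ₘ ρ) Set.univ = ENNReal.ofReal (1 - γ)⁻¹ := by
  rw [resolvent_comp, Measure.sum_apply _ MeasurableSet.univ]
  simp only [Measure.smul_apply, measure_univ, smul_eq_mul, mul_one]
  rw [← ENNReal.ofReal_tsum_of_nonneg (fun t => pow_nonneg hγ0 t)
    (summable_geometric_of_lt_one hγ0 hγ1), tsum_geometric_of_lt_one hγ0 hγ1]

lemma isFiniteMeasure_resolvent_comp (ρ : Measure X) [IsProbabilityMeasure ρ] :
    IsFiniteMeasure (resolvent γ κ ∘ₘ ρ) :=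
  ⟨by rw [resolvent_comp_univ hγ0 hγ1]; exact ENNReal.ofReal_lt_top⟩

lemma resolvent_univ (x : X) : resolvent γ κ x Set.univ = ENNReal.ofReal (1 - γ)⁻¹ := by
  rw [← resolvent_comp_univ hγ0 hγ1 κ (Measure.dirac x),
    Measure.dirac_bind (Kernel.measurable _)]

lemma isFiniteKernel_resolvent : IsFiniteKernel (resolvent γ κ) :=
  ⟨_, ENNReal.ofReal_lt_top, fun x => (resolvent_univ hγ0 hγ1 κ x).le⟩

variable {f : X → ℝ}

lemma integral_resolvent_comp (hf : BddMeasurable f) (ρ : Measure X) [IsProbabilityMeasure ρ] :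
    ∫ x, f x ∂(resolvent γ κ ∘ₘ ρ) = ∑' t, γ ^ t * ∫ x, f x ∂(⇑(κ ^ t) ∘ₘ ρ) := by
  have := isFiniteMeasure_resolvent_comp hγ0 hγ1 κ ρ
  have hint := hf.integrable (resolvent γ κ ∘ₘ ρ)
  rw [resolvent_comp] at hint ⊢
  simp only [integral_sum_measure hint, integral_smul_measure, smul_eq_mul,
    ENNReal.toReal_ofReal (pow_nonneg hγ0 _)]

lemma integral_resolvent (hf : BddMeasurable f) (x : X) :
    ∫ y, f y ∂resolvent γ κ x = ∑' t, γ ^ t * ∫ y, f y ∂(κ ^ t) x := by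
  simpa only [Measure.dirac_bind (Kernel.measurable _)]
    using integral_resolvent_comp hγ0 hγ1 κ hf (Measure.dirac x)

lemma integral_resolvent_eq_add (hf : BddMeasurable f) (x : X) :
    ∫ y, f y ∂resolvent γ κ x = f x + γ * ∫ y, ∫ z, f z ∂resolvent γ κ y ∂κ x := by
  obtain ⟨C, hC⟩ := hf.bdd
  have hbound : ∀ t y, |∫ z, f z ∂(κ ^ t) y| ≤ C := fun t y =>
    abs_integral_le_of_abs_le hC _
  have hzero : ∫ z, f z ∂(κ ^ 0) x = f x :=
    integral_dirac' _ _ hf.measurable.stronglyMeasurable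
  have hsucc : ∀ t, ∫ z, f z ∂(κ ^ (t + 1)) x = ∫ y, ∫ z, f z ∂(κ ^ t) y ∂κ x := fun t => by
    rw [pow_succ]
    exact Kernel.integral_comp (hf.integrable _)
  simp only [integral_resolvent hγ0 hγ1 κ hf]
  rw [integral_discounted hγ0 hγ1 (fun t => (hf.integral_kernel (κ ^ t)).measurable) hbound,
    (summable_discounted hγ0 hγ1 fun t => hbound t x).tsum_eq_zero_add, ← tsum_mul_left]
  rw [hzero, pow_zero, one_mul]
  simp only [hsucc, pow_succ' γ, mul_assoc]

lemma integral_sub_resolvent_comp (hf : BddMeasurable f) (ρ : Measure X)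
    [IsProbabilityMeasure ρ] :
    ∫ x, (f x - γ * ∫ y, f y ∂κ x) ∂(resolvent γ κ ∘ₘ ρ) = ∫ x, f x ∂ρ := by
  obtain ⟨C, hC⟩ := hf.bdd
  have hbound : ∀ t, |∫ x, f x ∂(⇑(κ ^ t) ∘ₘ ρ)| ≤ C := fun t => abs_integral_le_of_abs_le hC _
  have hsum := summable_discounted hγ0 hγ1 hbound
  have hterm : ∀ t, γ ^ t * ∫ x, (f x - γ * ∫ y, f y ∂κ x) ∂(⇑(κ ^ t) ∘ₘ ρ)
      = γ ^ t * ∫ x, f x ∂(⇑(κ ^ t) ∘ₘ ρ)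
        - γ ^ (t + 1) * ∫ x, f x ∂(⇑(κ ^ (t + 1)) ∘ₘ ρ) := fun t => by
    have hκ : ∫ x, ∫ y, f y ∂κ x ∂(⇑(κ ^ t) ∘ₘ ρ) = ∫ x, f x ∂(⇑(κ ^ (t + 1)) ∘ₘ ρ) := by
      rw [pow_succ', show κ * κ ^ t = κ ∘ₖ (κ ^ t) from rfl, ← Measure.comp_assoc,
        integral_comp_measure (hf.integrable _)]
    rw [integral_sub (hf.integrable _) (((hf.integral_kernel κ).const_mul γ).integrable _),
      integral_const_mul, hκ]
    ring
  have hzero : ∫ x, f x ∂(⇑(κ ^ 0) ∘ₘ ρ) = ∫ x, f x ∂ρ := by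
    rw [pow_zero, show (1 : Kernel X X) = Kernel.id from rfl, Measure.id_comp]
  rw [integral_resolvent_comp hγ0 hγ1 κ (hf.sub ((hf.integral_kernel κ).const_mul γ)),
    tsum_congr hterm, hsum.tsum_sub ((summable_nat_add_iff 1).2 hsum), hsum.tsum_eq_zero_add,
    hzero, pow_zero, one_mul, add_sub_cancel_right]

lemma abs_le_of_abs_sub_integral_le (hf : BddMeasurable f) {K : ℝ}
    (hK : ∀ x, |f x - γ * ∫ y, f y ∂κ x| ≤ K) (x : X) : |f x| ≤ K / (1 - γ) := by
  have hflow := integral_sub_resolvent_comp hγ0 hγ1 κ hf (Measure.dirac x)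
  rw [Measure.dirac_bind (Kernel.measurable _),
    integral_dirac' _ _ hf.measurable.stronglyMeasurable] at hflow
  have := isFiniteKernel_resolvent hγ0 hγ1 κ
  have hmass : (resolvent γ κ x).real Set.univ = (1 - γ)⁻¹ := by
    rw [Measure.real, resolvent_univ hγ0 hγ1,
      ENNReal.toReal_ofReal (inv_nonneg.2 (sub_nonneg.2 hγ1.le))]
  calc |f x| ≤ K * (resolvent γ κ x).real Set.univ :=
        hflow ▸ abs_integral_le_mul_real_univ hK _
    _ = K / (1 - γ) := by rw [hmass, div_eq_mul_inv]

end Resolvent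

section ChainMeasure

variable {X : Type*} [MeasurableSpace X] (κ : Kernel X X) [IsMarkovKernel κ]

/-- The law on trajectories of the time-homogeneous Markov chain with transition kernel `κ` and
initial law `ρ`. -/
def chainMeasure (κ : Kernel X X) [IsMarkovKernel κ] (ρ : Measure X) : Measure (ℕ → X) :=
  Kernel.trajMeasure (X := fun _ => X) ρ fun n =>
    κ.comap (fun h : Finset.Iic n → X => h ⟨n, Finset.mem_Iic.2 le_rfl⟩) (measurable_pi_apply _)

variable (ρ : Measure X)

instance isProbabilityMeasure_chainMeasure [IsProbabilityMeasure ρ] :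
    IsProbabilityMeasure (chainMeasure κ ρ) := by
  unfold chainMeasure
  infer_instance

lemma map_compProd {Y : Type*} [MeasurableSpace Y] (ν : Measure Y) [SFinite ν] {φ : Y → X}
    (hφ : Measurable φ) : ν.map φ ⊗ₘ κ = (ν ⊗ₘ κ.comap φ hφ).map (Prod.map φ id) := by
  have hprod : Measurable (Prod.map φ (id : X → X)) := hφ.prodMap measurable_id
  ext s hs
  rw [Measure.compProd_apply hs, lintegral_map (Kernel.measurable_kernel_prodMk_left hs) hφ,
    Measure.map_apply hprod hs, Measure.compProd_apply (hprod hs)]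
  rfl

lemma chainMeasure_map_zero : (chainMeasure κ ρ).map (fun ω => ω 0) = ρ := by
  have hfirst : (chainMeasure κ ρ).map (Preorder.frestrictLe 0)
      = ρ.map (MeasurableEquiv.piUnique (fun _ : Finset.Iic 0 => X)).symm := by
    rw [chainMeasure, Kernel.trajMeasure, Measure.map_comp _ _ (by fun_prop),
      Kernel.traj_map_frestrictLe, Kernel.partialTraj_self]
    exact Measure.id_comp
  have heval : (fun ω : ℕ → X => ω 0)
      = (fun h : Finset.Iic 0 → X => h ⟨0, by simp⟩) ∘ Preorder.frestrictLe 0 := rfl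
  rw [heval, ← Measure.map_map (by fun_prop) (by fun_prop), hfirst,
    Measure.map_map (by fun_prop) (by fun_prop)]
  exact Measure.map_id

variable [IsProbabilityMeasure ρ]

lemma chainMeasure_map_pair (t : ℕ) :
    (chainMeasure κ ρ).map (fun ω => (ω t, ω (t + 1)))
      = (chainMeasure κ ρ).map (fun ω => ω t) ⊗ₘ κ := by
  let last : (Finset.Iic t → X) → X := fun h => h ⟨t, Finset.mem_Iic.2 le_rfl⟩
  have hlast : Measurable last := measurable_pi_apply _
  have hhist : (chainMeasure κ ρ).map (fun ω => (Preorder.frestrictLe t ω, ω (t + 1)))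
      = (chainMeasure κ ρ).map (Preorder.frestrictLe (π := fun _ => X) t) ⊗ₘ
        κ.comap last hlast :=
    Kernel.map_frestrictLe_trajMeasure_compProd_eq_map_trajMeasure.symm
  have hpair : (fun ω : ℕ → X => (ω t, ω (t + 1)))
      = Prod.map last id ∘ fun ω => (Preorder.frestrictLe t ω, ω (t + 1)) := rfl
  have heval : (fun ω : ℕ → X => ω t) = last ∘ Preorder.frestrictLe t := rfl
  rw [hpair, ← Measure.map_map (by fun_prop) (by fun_prop), hhist, heval,
    ← Measure.map_map (by fun_prop) (by fun_prop), map_compProd κ _ hlast]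

lemma chainMeasure_map_eval (t : ℕ) :
    (chainMeasure κ ρ).map (fun ω => ω t) = ⇑(κ ^ t) ∘ₘ ρ := by
  induction t with
  | zero => rw [chainMeasure_map_zero]; exact Measure.id_comp.symm
  | succ t ih =>
    have hsnd : (fun ω : ℕ → X => ω (t + 1)) = Prod.snd ∘ fun ω => (ω t, ω (t + 1)) := rfl
    have : IsProbabilityMeasure ((chainMeasure κ ρ).map fun ω => ω t) :=
      Measure.isProbabilityMeasure_map (measurable_pi_apply t).aemeasurable
    rw [hsnd, ← Measure.map_map (by fun_prop) (by fun_prop), chainMeasure_map_pair,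
      show ∀ μ : Measure (X × X), μ.map Prod.snd = μ.snd from fun _ => rfl,
      Measure.snd_compProd, ih, Measure.comp_assoc, pow_succ']
    rfl

lemma integral_chainMeasure_discounted {γ : ℝ} (hγ0 : 0 ≤ γ) (hγ1 : γ < 1) {g : X × X → ℝ}
    (hg : BddMeasurable g) :
    ∫ ω, ∑' t, γ ^ t * g (ω t, ω (t + 1)) ∂chainMeasure κ ρ
      = ∫ x, ∫ y, g (x, y) ∂κ x ∂(resolvent γ κ ∘ₘ ρ) := by
  obtain ⟨C, hC⟩ := hg.bdd
  have hpair : ∀ t, ∫ ω, g (ω t, ω (t + 1)) ∂chainMeasure κ ρ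
      = ∫ x, ∫ y, g (x, y) ∂κ x ∂(⇑(κ ^ t) ∘ₘ ρ) := fun t => by
    rw [← Measure.integral_compProd (hg.integrable _), ← chainMeasure_map_eval,
      ← chainMeasure_map_pair,
      integral_map (by fun_prop) hg.measurable.aestronglyMeasurable]
  have hdisc := integral_discounted hγ0 hγ1 (f := fun t ω => g (ω t, ω (t + 1)))
      (fun t => hg.measurable.comp (by fun_prop)) (fun t ω => hC _)
    (chainMeasure κ ρ)
  rw [hdisc, integral_resolvent_comp hγ0 hγ1 κ (hg.integral_kernel_prod_right κ)]
  exact tsum_congr fun t => congrArg (γ ^ t * ·) (hpair t)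

end ChainMeasure

/-! ### Soft values and the performance difference -/

section SoftValues

variable {S : Type*} [MeasurableSpace S] {μ : Measure S} [IsFiniteMeasure μ]
  {m : ℕ} {A : Compacts (Eu m)}

lemma integral_withDensity_ofReal {X : Type*} [MeasurableSpace X] {ν : Measure X} {p : X → ℝ}
    (hp : Measurable p) (hp0 : ∀ x, 0 ≤ p x) (g : X → ℝ) :
    ∫ x, g x ∂ν.withDensity (fun x => ENNReal.ofReal (p x)) = ∫ x, p x * g x ∂ν := by
  rw [integral_withDensity_eq_integral_toReal_smul hp.ennreal_ofReal
    (.of_forall fun _ => ENNReal.ofReal_lt_top)]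
  simp [ENNReal.toReal_ofReal (hp0 _)]

lemma Policy.integral_kernel (π : Policy S A) (s : S) (g : A → ℝ) :
    ∫ a, g a ∂π.kernel s = ∫ a, π.dens s a * g a ∂actionMeasure A := by
  have h : Measurable (Function.uncurry fun (s : S) (a : A) => ENNReal.ofReal (π.dens s a)) :=
    π.measurable_dens.ennreal_ofReal
  rw [Policy.kernel, Kernel.withDensity_apply _ h, Kernel.const_apply,
    integral_withDensity_ofReal π.measurable_dens.of_uncurry_left (π.dens_nonneg s)]

lemma Policy.integrable_dens (π : Policy S A) (s : S) :
    Integrable (π.dens s) (actionMeasure A) := by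
  refine ⟨π.measurable_dens.of_uncurry_left.aestronglyMeasurable, ?_⟩
  rw [hasFiniteIntegral_iff_ofReal (.of_forall (π.dens_nonneg s)), π.lintegral_dens]
  exact ENNReal.one_lt_top

lemma MDP.integral_transKernel (M : MDP S μ A) (x : S × A) (g : S → ℝ) :
    ∫ s', g s' ∂M.transKernel x = ∫ s', M.trans x.1 x.2 s' * g s' ∂μ := by
  have h : Measurable
      (Function.uncurry fun (x : S × A) (s' : S) => ENNReal.ofReal (M.trans x.1 x.2 s')) :=
    M.measurable_trans.ennreal_ofReal
  have htrans : Measurable (M.trans x.1 x.2) :=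
    M.measurable_trans.comp measurable_prodMk_left
  rw [MDP.transKernel, Kernel.withDensity_apply _ h, Kernel.const_apply,
    integral_withDensity_ofReal htrans (M.trans_nonneg x.1 x.2)]

/-- The kernel sending a state `s` to the law of `(s, a)` with `a ∼ π(· | s)`. -/
def Policy.stateAction (π : Policy S A) : Kernel S (S × A) :=
  Kernel.id ×ₖ π.kernel

instance Policy.isMarkovKernel_stateAction (π : Policy S A) : IsMarkovKernel π.stateAction := by
  unfold Policy.stateAction
  infer_instance

lemma Policy.stateAction_comp (π : Policy S A) (ν : Measure S) [SFinite ν] :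
    π.stateAction ∘ₘ ν = ν ⊗ₘ π.kernel :=
  (Measure.compProd_eq_comp_prod ν π.kernel).symm

lemma Policy.integral_stateAction (π : Policy S A) {f : S × A → ℝ} (hf : BddMeasurable f) (s : S) :
    ∫ x, f x ∂π.stateAction s = ∫ a, f (s, a) ∂π.kernel s := by
  rw [← Measure.dirac_bind (Kernel.measurable π.stateAction), π.stateAction_comp,
    Measure.integral_compProd (hf.integrable _)]
  exact integral_dirac' _ _
    (hf.integral_kernel_prod_right π.kernel).measurable.stronglyMeasurable

/-- One step of the chain of states under the policy `π`. -/
def MDP.stateKernel (M : MDP S μ A) (π : Policy S A) : Kernel S S :=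
  M.transKernel ∘ₖ π.stateAction

instance MDP.isMarkovKernel_stateKernel (M : MDP S μ A) (π : Policy S A) :
    IsMarkovKernel (M.stateKernel π) := by
  unfold MDP.stateKernel
  infer_instance

variable {M : MDP S μ A} {π : Policy S A}

lemma MDP.integral_stateKernel {f : S → ℝ} (hf : BddMeasurable f) (s : S) :
    ∫ s', f s' ∂M.stateKernel π s = ∫ a, ∫ s', f s' ∂M.transKernel (s, a) ∂π.kernel s := by
  rw [MDP.stateKernel, Kernel.integral_comp (hf.integrable _),
    π.integral_stateAction (hf.integral_kernel M.transKernel)]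

lemma MDP.step_eq_stateAction_comp : M.step π = π.stateAction ∘ₖ M.transKernel :=
  Kernel.compProd_prodMkLeft_eq_comp _ _

lemma MDP.integral_step {f : S × A → ℝ} (hf : BddMeasurable f) (x : S × A) :
    ∫ y, f y ∂M.step π x = ∫ s', ∫ a, f (s', a) ∂π.kernel s' ∂M.transKernel x := by
  rw [MDP.step, ProbabilityTheory.integral_compProd (hf.integrable _)]
  rfl

lemma MDP.step_comp_stateAction : M.step π ∘ₖ π.stateAction = π.stateAction ∘ₖ M.stateKernel π := by
  rw [MDP.step_eq_stateAction_comp, MDP.stateKernel, Kernel.comp_assoc]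

lemma MDP.occupancy_eq_resolvent_comp :
    M.occupancy π = resolvent M.disc (M.stateKernel π) ∘ₘ M.initMeasure := by
  have hlaw : ∀ t, (M.law π).map (fun ω => (ω t).1)
      = ⇑(M.stateKernel π ^ t) ∘ₘ M.initMeasure := fun t => by
    have hpath : (M.law π).map (fun ω => ω t)
        = (⇑(M.stateKernel π ^ t) ∘ₘ M.initMeasure) ⊗ₘ π.kernel := by
      rw [← π.stateAction_comp, Measure.comp_assoc,
        ← pow_comp_eq_comp_pow MDP.step_comp_stateAction, ← Measure.comp_assoc, π.stateAction_comp]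
      exact chainMeasure_map_eval (M.step π) (M.initMeasure ⊗ₘ π.kernel) t
    rw [show (fun ω : ℕ → S × A => (ω t).1) = Prod.fst ∘ fun ω => ω t from rfl,
      ← Measure.map_map measurable_fst (measurable_pi_apply t), hpath]
    exact Measure.fst_compProd _ _
  rw [resolvent_comp, MDP.occupancy]
  simp only [hlaw]

instance MDP.isFiniteMeasure_occupancy : IsFiniteMeasure (M.occupancy π) := by
  rw [MDP.occupancy_eq_resolvent_comp]
  exact isFiniteMeasure_resolvent_comp M.disc_nonneg M.disc_lt_one _ _

lemma MDP.integral_sub_occupancy {f : S → ℝ} (hf : BddMeasurable f) :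
    ∫ s, (f s - M.disc * ∫ s', f s' ∂M.stateKernel π s) ∂M.occupancy π
      = ∫ s, f s ∂M.initMeasure := by
  rw [MDP.occupancy_eq_resolvent_comp]
  exact integral_sub_resolvent_comp M.disc_nonneg M.disc_lt_one _ hf _

lemma MDP.resolvent_step_comp_eq_occupancy_compProd :
    resolvent M.disc (M.step π) ∘ₘ (M.initMeasure ⊗ₘ π.kernel) = M.occupancy π ⊗ₘ π.kernel := by
  rw [← π.stateAction_comp, resolvent_comp_comp MDP.step_comp_stateAction,
    ← MDP.occupancy_eq_resolvent_comp, π.stateAction_comp]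

variable {α : ℝ}

lemma MDP.objective_eq_integral_occupancy
    (hr : BddMeasurable fun x : S × A => M.reward x.1 x.2) (hH : BddMeasurable π.entropy) :
    M.objective α π
      = ∫ s, (∫ a, M.reward s a ∂π.kernel s + α * π.entropy s) ∂M.occupancy π := by
  have hg : BddMeasurable fun x : S × A => M.reward x.1 x.2 + α * π.entropy x.1 :=
    hr.add ((hH.comp measurable_fst).const_mul α)
  calc M.objective α π
      = ∫ x, ∫ _, (M.reward x.1 x.2 + α * π.entropy x.1) ∂M.step π x
          ∂(resolvent M.disc (M.step π) ∘ₘ (M.initMeasure ⊗ₘ π.kernel)) :=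
        integral_chainMeasure_discounted (M.step π) _ M.disc_nonneg M.disc_lt_one
          (hg.comp measurable_fst)
    _ = ∫ s, ∫ a, (M.reward s a + α * π.entropy s) ∂π.kernel s ∂M.occupancy π := by
        simp only [integral_const, probReal_univ, one_smul]
        rw [MDP.resolvent_step_comp_eq_occupancy_compProd,
          Measure.integral_compProd (hg.integrable _)]
    _ = ∫ s, (∫ a, M.reward s a ∂π.kernel s + α * π.entropy s) ∂M.occupancy π := by
        refine integral_congr_ae (.of_forall fun s => ?_)
        beta_reduce
        rw [integral_add ((hr.comp measurable_prodMk_left).integrable _) (integrable_const _),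
          integral_const, probReal_univ, one_smul]

lemma MDP.softQ_eq_integral_resolvent
    (hr : BddMeasurable fun x : S × A => M.reward x.1 x.2) (hH : BddMeasurable π.entropy)
    (s : S) (a : A) :
    M.softQ α π s a = ∫ x, (M.reward x.1 x.2
      + α * M.disc * ∫ s', π.entropy s' ∂M.transKernel x) ∂resolvent M.disc (M.step π) (s, a) := by
  have hH' : BddMeasurable fun x : S × A => α * M.disc * π.entropy x.1 :=
    (hH.comp measurable_fst).const_mul (α * M.disc)
  have hg : BddMeasurable fun z : (S × A) × (S × A) =>
      M.reward z.1.1 z.1.2 + α * M.disc * π.entropy z.2.1 :=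
    (hr.comp measurable_fst).add (hH'.comp measurable_snd)
  rw [← Measure.dirac_bind (Kernel.measurable (resolvent M.disc (M.step π)))]
  refine (integral_chainMeasure_discounted (M.step π) _ M.disc_nonneg M.disc_lt_one hg).trans ?_
  refine integral_congr_ae (.of_forall fun x => ?_)
  change ∫ y, (M.reward x.1 x.2 + α * M.disc * π.entropy y.1) ∂M.step π x = _
  rw [integral_add (integrable_const _) (hH'.integrable _), integral_const, probReal_univ,
    one_smul, integral_const_mul, MDP.integral_step (hH.comp measurable_fst)]
  simp only [integral_const, probReal_univ, one_smul]

lemma MDP.bddMeasurable_softQ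
    (hr : BddMeasurable fun x : S × A => M.reward x.1 x.2) (hH : BddMeasurable π.entropy) :
    BddMeasurable fun x : S × A => M.softQ α π x.1 x.2 := by
  have := isFiniteKernel_resolvent M.disc_nonneg M.disc_lt_one (M.step π)
  simp only [MDP.softQ_eq_integral_resolvent hr hH]
  exact (hr.add ((hH.integral_kernel M.transKernel).const_mul _)).integral_kernel _

/-- The expected soft return when the first action is drawn from `π'` (with its entropy bonus) and
all later ones from `π`. It interpolates between the soft state values of the two policies. -/
def MDP.oneStepValue (M : MDP S μ A) (α : ℝ) (π' π : Policy S A) (s : S) : ℝ :=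
  ∫ a, M.softQ α π s a ∂π'.kernel s + α * π'.entropy s

/-- The soft state value `V_π(s)`, which includes the entropy bonus of the first action. -/
def MDP.softValue (M : MDP S μ A) (α : ℝ) (π : Policy S A) : S → ℝ :=
  M.oneStepValue α π π

variable {π' : Policy S A} (hr : BddMeasurable fun x : S × A => M.reward x.1 x.2)
  (hH : BddMeasurable π.entropy)
include hr hH

lemma MDP.bddMeasurable_oneStepValue (hH' : BddMeasurable π'.entropy) :
    BddMeasurable (M.oneStepValue α π' π) :=
  ((MDP.bddMeasurable_softQ hr hH).integral_kernel_prod_right π'.kernel).add (hH'.const_mul α)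

lemma MDP.bddMeasurable_softValue : BddMeasurable (M.softValue α π) :=
  MDP.bddMeasurable_oneStepValue hr hH hH

lemma MDP.softQ_eq_reward_add_softValue (s : S) (a : A) :
    M.softQ α π s a
      = M.reward s a + M.disc * ∫ s', M.softValue α π s' ∂M.transKernel (s, a) := by
  have hc := hr.add ((hH.integral_kernel M.transKernel).const_mul (α * M.disc))
  have hQ := MDP.bddMeasurable_softQ (α := α) hr hH
  have hstep : ∫ y, M.softQ α π y.1 y.2 ∂M.step π (s, a)
      = ∫ s', (M.softValue α π s' - α * π.entropy s') ∂M.transKernel (s, a) := by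
    rw [MDP.integral_step hQ]
    simp only [MDP.softValue, MDP.oneStepValue, add_sub_cancel_right]
  have hbellman := integral_resolvent_eq_add M.disc_nonneg M.disc_lt_one (M.step π) hc (s, a)
  simp only [← MDP.softQ_eq_integral_resolvent hr hH] at hbellman
  rw [hbellman, hstep, integral_sub ((MDP.bddMeasurable_softValue hr hH).integrable _)
    ((hH.const_mul α).integrable _), integral_const_mul]
  ring

lemma MDP.oneStepValue_eq (s : S) :
    M.oneStepValue α π' π s = ∫ a, M.reward s a ∂π'.kernel s + α * π'.entropy s
      + M.disc * ∫ s', M.softValue α π s' ∂M.stateKernel π' s := by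
  have hV := MDP.bddMeasurable_softValue (α := α) hr hH
  simp only [MDP.oneStepValue, MDP.softQ_eq_reward_add_softValue hr hH]
  rw [integral_add ((hr.comp measurable_prodMk_left).integrable _)
    ((((hV.integral_kernel M.transKernel).comp measurable_prodMk_left).const_mul _).integrable _),
    integral_const_mul, MDP.integral_stateKernel hV]
  ring

lemma MDP.objective_eq_integral_softValue :
    M.objective α π = ∫ s, M.softValue α π s ∂M.initMeasure := by
  rw [← MDP.integral_sub_occupancy (π := π) (MDP.bddMeasurable_softValue hr hH),
    MDP.objective_eq_integral_occupancy hr hH]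
  refine integral_congr_ae (.of_forall fun s => ?_)
  simp only [MDP.softValue, MDP.oneStepValue_eq hr hH s]
  ring

lemma MDP.softValue_sub_oneStepValue (hH' : BddMeasurable π'.entropy) (s : S) :
    M.softValue α π' s - M.oneStepValue α π' π s
      = M.disc * ∫ s', (M.softValue α π' s' - M.softValue α π s') ∂M.stateKernel π' s := by
  have hV' : M.softValue α π' s = _ := MDP.oneStepValue_eq hr hH' s
  rw [hV', MDP.oneStepValue_eq hr hH,
    integral_sub ((MDP.bddMeasurable_softValue hr hH').integrable _)
      ((MDP.bddMeasurable_softValue hr hH).integrable _)]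
  ring

lemma MDP.abs_softValue_sub_le (hH' : BddMeasurable π'.entropy) {K : ℝ}
    (hK : ∀ s, |M.oneStepValue α π' π s - M.softValue α π s| ≤ K) (s : S) :
    |M.softValue α π' s - M.softValue α π s| ≤ K / (1 - M.disc) := by
  refine abs_le_of_abs_sub_integral_le M.disc_nonneg M.disc_lt_one (M.stateKernel π')
    ((MDP.bddMeasurable_softValue hr hH').sub (MDP.bddMeasurable_softValue hr hH)) (fun s => ?_) s
  rw [← MDP.softValue_sub_oneStepValue hr hH hH' s, sub_sub_sub_cancel_left]
  exact hK s

omit hr hH in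
lemma MDP.abs_integral_stateKernel_sub_le {f : S → ℝ} (hf : BddMeasurable f) {K : ℝ}
    (hK : ∀ s, |f s| ≤ K) (s : S) :
    |∫ s', f s' ∂M.stateKernel π' s - ∫ s', f s' ∂M.stateKernel π s|
      ≤ K * ∫ a, |π'.dens s a - π.dens s a| ∂actionMeasure A := by
  have hnext : BddMeasurable fun a : A => ∫ s', f s' ∂M.transKernel (s, a) :=
    (hf.integral_kernel M.transKernel).comp measurable_prodMk_left
  obtain ⟨C, hC⟩ := hnext.bdd
  have hint : ∀ π : Policy S A, Integrable
      (fun a => π.dens s a * ∫ s', f s' ∂M.transKernel (s, a)) (actionMeasure A) := fun π =>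
    (π.integrable_dens s).mul_bdd (c := C) hnext.measurable.aestronglyMeasurable (.of_forall hC)
  rw [MDP.integral_stateKernel hf, MDP.integral_stateKernel hf, Policy.integral_kernel,
    Policy.integral_kernel, ← integral_sub (hint π') (hint π), ← integral_const_mul,
    ← Real.norm_eq_abs]
  refine norm_integral_le_of_norm_le
    ((((π'.integrable_dens s).sub (π.integrable_dens s)).abs).const_mul K) (.of_forall fun a => ?_)
  rw [← sub_mul, norm_mul, mul_comm]
  exact mul_le_mul_of_nonneg_right (abs_integral_le_of_abs_le hK _) (norm_nonneg _)

/-- The value difference and the change of the state kernel are both of first order in the distance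
between the policies, so freezing the kernel at that of `π` costs a second-order error. -/
lemma MDP.abs_objective_sub_le (hH' : BddMeasurable π'.entropy) {K D : ℝ}
    (hK : ∀ s, |M.oneStepValue α π' π s - M.softValue α π s| ≤ K)
    (hD : ∀ s, ∫ a, |π'.dens s a - π.dens s a| ∂actionMeasure A ≤ D) :
    |M.objective α π' - M.objective α π
        - ∫ s, (M.oneStepValue α π' π s - M.softValue α π s) ∂M.occupancy π|
      ≤ M.disc * (K / (1 - M.disc) * D) * (M.occupancy π).real Set.univ := by
  set u : S → ℝ := fun s => M.softValue α π' s - M.softValue α π s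
  have hV := MDP.bddMeasurable_softValue (α := α) hr hH
  have hV' := MDP.bddMeasurable_softValue (α := α) hr hH'
  have hu : BddMeasurable u := hV'.sub hV
  have hW := MDP.bddMeasurable_oneStepValue (α := α) hr hH hH'
  have hflow : M.objective α π' - M.objective α π
      = ∫ s, (u s - M.disc * ∫ s', u s' ∂M.stateKernel π s) ∂M.occupancy π := by
    rw [MDP.integral_sub_occupancy hu, integral_sub (hV'.integrable _) (hV.integrable _),
      MDP.objective_eq_integral_softValue hr hH, MDP.objective_eq_integral_softValue hr hH']
  have hkernel : ∀ s, (u s - M.disc * ∫ s', u s' ∂M.stateKernel π s)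
        - (M.oneStepValue α π' π s - M.softValue α π s)
      = M.disc * (∫ s', u s' ∂M.stateKernel π' s - ∫ s', u s' ∂M.stateKernel π s) := fun s => by
    rw [mul_sub, ← MDP.softValue_sub_oneStepValue hr hH hH' s]
    ring
  rw [hflow, ← integral_sub ((hu.sub ((hu.integral_kernel _).const_mul _)).integrable _)
    ((hW.sub hV).integrable _)]
  refine abs_integral_le_mul_real_univ (fun s => ?_) _
  have hu_le := MDP.abs_softValue_sub_le hr hH hH' hK
  rw [hkernel, abs_mul, abs_of_nonneg M.disc_nonneg]
  refine mul_le_mul_of_nonneg_left ?_ M.disc_nonneg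
  exact (MDP.abs_integral_stateKernel_sub_le hu hu_le s).trans
    (mul_le_mul_of_nonneg_left (hD s) ((abs_nonneg _).trans (hu_le s)))

end SoftValues

/-! ### Jointly continuously differentiable families -/

lemma exists_eventually_forall_norm_le {Y Z F : Type*} [TopologicalSpace Y] [CompactSpace Y]
    [TopologicalSpace Z] [NormedAddCommGroup F] {p : Z → Y → F}
    (hp : Continuous fun x : Z × Y => p x.1 x.2) (z : Z) :
    ∃ C, ∀ᶠ w in 𝓝 z, ∀ y, ‖p w y‖ ≤ C := by
  obtain ⟨C, hC⟩ := isCompact_univ.exists_bound_of_continuousOn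
    (hp.comp (Continuous.prodMk_right z)).continuousOn
  refine ⟨C + 1, ?_⟩
  simpa using isCompact_univ.eventually_forall_of_forall_eventually (x₀ := z)
    (P := fun w y => ‖p w y‖ ≤ C + 1) fun y hy =>
      (hp.norm.tendsto (z, y)).eventually_le_const ((hC y hy).trans_lt (lt_add_one C))

lemma continuous_integral_smul {Y Z F : Type*} [TopologicalSpace Y] [CompactSpace Y]
    [SecondCountableTopology Y] [MeasurableSpace Y] [OpensMeasurableSpace Y] [TopologicalSpace Z]
    [FirstCountableTopology Z] [NormedAddCommGroup F] [NormedSpace ℝ F] {V : Y → ℝ}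
    (hV : BddMeasurable V) {p : Z → Y → F} (hp : Continuous fun x : Z × Y => p x.1 x.2)
    (ν : Measure Y) [IsFiniteMeasure ν] : Continuous fun z => ∫ y, V y • p z y ∂ν := by
  obtain ⟨C, hC0, hC⟩ := hV.exists_nonneg_bound
  refine continuous_iff_continuousAt.2 fun z => ?_
  obtain ⟨B, hB⟩ := exists_eventually_forall_norm_le hp z
  refine continuousAt_of_dominated (bound := fun _ => C * B) (.of_forall fun w => ?_) ?_
    (integrable_const _) (.of_forall fun y => ?_)
  · exact hV.measurable.aestronglyMeasurable.smul
      (hp.comp (Continuous.prodMk_right w)).aestronglyMeasurable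
  · filter_upwards [hB] with w hw
    refine .of_forall fun y => ?_
    rw [norm_smul]
    exact mul_le_mul (hC y) (hw y) (norm_nonneg _) hC0
  · exact ((hp.comp (Continuous.prodMk_left y)).const_smul (V y)).continuousAt

lemma hasFDerivAt_diag {E F : Type*} [NormedAddCommGroup E] [NormedSpace ℝ E]
    [NormedAddCommGroup F] [NormedSpace ℝ F] {g : E → E → F} {D : E → E → E →L[ℝ] F}
    {L : E →L[ℝ] F} {z : E} (hD : ∀ v w, HasFDerivAt (g v) (D v w) w)
    (hDc : ContinuousAt (fun p : E × E => D p.1 p.2) (z, z))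
    (hL : HasFDerivAt (fun v => g v z) L z) :
    HasFDerivAt (fun v => g v v) (D z z + L) z := by
  have hinner : HasFDerivAt (fun v => g v v - g v z) (D z z) z := by
    rw [hasFDerivAt_iff_isLittleO, Asymptotics.isLittleO_iff]
    intro c hc
    obtain ⟨δ, hδ, hball⟩ := Metric.continuousAt_iff.1 hDc c hc
    filter_upwards [Metric.ball_mem_nhds z hδ] with v hv
    -- Mean value inequality in the second variable, with a bound uniform in the first.
    have hmean := (convex_ball z δ).norm_image_sub_le_of_norm_hasFDerivWithin_le' (C := c)
      (φ := D z z) (fun w _ => (hD v w).hasFDerivWithinAt) (fun w hw => ?_)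
      (Metric.mem_ball_self hδ) hv
    · simpa using hmean
    · rw [← dist_eq_norm]
      exact (hball (x := (v, w)) (by rw [Prod.dist_eq]; exact max_lt hv hw)).le
  simpa [Pi.add_def] using hinner.add hL

lemma toDual_integral_gradient {X E : Type*} [MeasurableSpace X] [NormedAddCommGroup E]
    [InnerProductSpace ℝ E] [CompleteSpace E] (g : X → E → ℝ) (ν : Measure X) (z : E) :
    InnerProductSpace.toDual ℝ E (∫ x, gradient (g x) z ∂ν) = ∫ x, fderiv ℝ (g x) z ∂ν := by
  have hfderiv : ∀ x, fderiv ℝ (g x) z = InnerProductSpace.toDual ℝ E (gradient (g x) z) :=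
    fun x => ((InnerProductSpace.toDual ℝ E).apply_symm_apply _).symm
  simp only [hfderiv]
  exact ((InnerProductSpace.toDual ℝ E).toContinuousLinearEquiv.integral_comp_comm _).symm

lemma hasGradientAt_of_isBigO_sub_sub {E : Type*} [NormedAddCommGroup E] [InnerProductSpace ℝ E]
    [CompleteSpace E] {f g : E → ℝ} {v z : E} (hg : HasGradientAt g v z)
    (h : (fun w => f w - f z - (g w - g z)) =O[𝓝 z] fun w => ‖w - z‖ ^ 2) :
    HasGradientAt f v z := by
  have hsum := (hg.hasFDerivAt.add (h.hasFDerivAt (𝕜 := ℝ) one_lt_two)).add_const (f z - g z)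
  rw [add_zero] at hsum
  rw [hasGradientAt_iff_hasFDerivAt]
  refine hsum.congr_of_eventuallyEq (.of_forall fun w => ?_)
  simp only [Pi.add_apply]
  ring

/-- `g x z` and its derivative in the parameter `z` are jointly continuous in `(x, z)`. -/
structure JointC1 {X E F : Type*} [TopologicalSpace X] [NormedAddCommGroup E] [NormedSpace ℝ E]
    [NormedAddCommGroup F] [NormedSpace ℝ F] (g : X → E → F) : Prop where
  continuous : Continuous fun y : X × E => g y.1 y.2
  differentiable : ∀ x, Differentiable ℝ (g x)
  continuous_fderiv : Continuous fun y : X × E => fderiv ℝ (g y.1) y.2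

lemma HasContDerivParam.jointC1 {X F : Type*} [TopologicalSpace X] [NormedAddCommGroup F]
    [NormedSpace ℝ F] {d : ℕ} {g : X → Eu d → F} (hg : HasContDerivParam g)
    (hgc : Continuous fun y : X × Eu d => g y.1 y.2) : JointC1 g := by
  obtain ⟨D, hD, hd⟩ := hg
  exact ⟨hgc, fun x z => (hd x z).differentiableAt, by simpa only [(hd _ _).fderiv] using hD⟩

lemma HasContDerivAction.comp {X Y : Type*} [TopologicalSpace X] [TopologicalSpace Y] {m : ℕ}
    {A : Compacts (Eu m)} {g : X → A → ℝ} (hg : HasContDerivAction g) {φ : Y → X}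
    (hφ : Continuous φ) : HasContDerivAction fun y a => g (φ y) a := by
  obtain ⟨G, D, hG, hD, hd⟩ := hg
  exact ⟨fun y => G (φ y), fun y => D (φ y), fun y => hG (φ y),
    hD.comp (by fun_prop : Continuous fun y : Y × A => (φ y.1, y.2)), fun y => hd (φ y)⟩

namespace JointC1

variable {X Y E F : Type*} [TopologicalSpace X] [TopologicalSpace Y] [NormedAddCommGroup E]
  [NormedSpace ℝ E] [NormedAddCommGroup F] [NormedSpace ℝ F]

lemma of_hasFDerivAt {g : X → E → F} {D : X → E → E →L[ℝ] F}
    (hg : Continuous fun y : X × E => g y.1 y.2) (hD : Continuous fun y : X × E => D y.1 y.2)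
    (hd : ∀ x z, HasFDerivAt (g x) (D x z) z) : JointC1 g :=
  ⟨hg, fun x z => (hd x z).differentiableAt, by simpa only [(hd _ _).fderiv] using hD⟩

lemma of_const {g : X → F} (hg : Continuous g) : JointC1 fun x (_ : E) => g x :=
  of_hasFDerivAt (hg.comp continuous_fst) continuous_const fun _ _ => hasFDerivAt_const _ _

variable {g h : X → E → F}

lemma hasFDerivAt (hg : JointC1 g) (x : X) (z : E) : HasFDerivAt (g x) (fderiv ℝ (g x) z) z :=
  (hg.differentiable x z).hasFDerivAt

lemma comp (hg : JointC1 g) {φ : Y → X} (hφ : Continuous φ) : JointC1 fun y z => g (φ y) z :=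
  ⟨hg.continuous.comp (by fun_prop : Continuous fun y : Y × E => (φ y.1, y.2)),
    fun y => hg.differentiable (φ y),
    hg.continuous_fderiv.comp (by fun_prop : Continuous fun y : Y × E => (φ y.1, y.2))⟩

lemma add (hg : JointC1 g) (hh : JointC1 h) : JointC1 fun x z => g x z + h x z :=
  of_hasFDerivAt (hg.continuous.add hh.continuous) (hg.continuous_fderiv.add hh.continuous_fderiv)
    fun x z => (hg.hasFDerivAt x z).add (hh.hasFDerivAt x z)

lemma sub (hg : JointC1 g) (hh : JointC1 h) : JointC1 fun x z => g x z - h x z :=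
  of_hasFDerivAt (hg.continuous.sub hh.continuous) (hg.continuous_fderiv.sub hh.continuous_fderiv)
    fun x z => (hg.hasFDerivAt x z).sub (hh.hasFDerivAt x z)

lemma sum {ι : Type*} (s : Finset ι) {f : ι → X → E → F} (hf : ∀ i ∈ s, JointC1 (f i)) :
    JointC1 fun x z => ∑ i ∈ s, f i x z :=
  of_hasFDerivAt (continuous_finsetSum s fun i hi => (hf i hi).continuous)
    (continuous_finsetSum s fun i hi => (hf i hi).continuous_fderiv)
    fun x z => .fun_sum fun i hi => (hf i hi).hasFDerivAt x z

lemma smul {c : X → E → ℝ} (hc : JointC1 c) (hg : JointC1 g) :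
    JointC1 fun x z => c x z • g x z := by
  have hc' := hc.continuous_fderiv
  have hg' := hg.continuous
  exact of_hasFDerivAt (hc.continuous.smul hg')
    ((hc.continuous.smul hg.continuous_fderiv).add (by fun_prop))
    fun x z => (hc.hasFDerivAt x z).smul (hg.hasFDerivAt x z)

lemma mul {g h : X → E → ℝ} (hg : JointC1 g) (hh : JointC1 h) : JointC1 fun x z => g x z * h x z :=
  hg.smul hh

lemma const_mul {g : X → E → ℝ} (hg : JointC1 g) (c : ℝ) : JointC1 fun x z => c * g x z :=
  (of_const continuous_const).mul hg

lemma log {g : X → E → ℝ} (hg : JointC1 g) (hpos : ∀ x z, 0 < g x z) :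
    JointC1 fun x z => Real.log (g x z) :=
  of_hasFDerivAt (hg.continuous.log fun y => (hpos y.1 y.2).ne')
    ((hg.continuous.inv₀ fun y => (hpos y.1 y.2).ne').smul hg.continuous_fderiv)
    fun x z => (hg.hasFDerivAt x z).log (hpos x z).ne'

lemma comp_action {m : ℕ} {A : Compacts (Eu m)} {g : X → E → A → ℝ} {f : X → E → A}
    (hg : JointC1 fun (y : X × A) z => g y.1 z y.2)
    (hga : HasContDerivAction fun (y : X × E) a => g y.1 y.2 a)
    (hf : JointC1 fun x z => (f x z : Eu m)) : JointC1 fun x z => g x z (f x z) := by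
  obtain ⟨G, D, hG, hD, hd⟩ := hga
  have hfc : Continuous fun y : X × E => f y.1 y.2 := continuous_induced_rng.2 hf.continuous
  have hpair : Continuous fun y : X × E => ((y.1, f y.1 y.2), y.2) := by fun_prop
  refine of_hasFDerivAt (hg.continuous.comp hpair)
    (D := fun x z => fderiv ℝ (fun w => g x w (f x z)) z
      + (D (x, z) (f x z)).comp (fderiv ℝ (fun w => (f x w : Eu m)) z))
    ((hg.continuous_fderiv.comp hpair).add
      ((hD.comp (continuous_id.prodMk hfc)).clm_comp hf.continuous_fderiv)) fun x z => ?_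
  refine hasFDerivAt_diag (g := fun v w => g x w (f x v))
    (fun v w => hg.hasFDerivAt (x, f x v) w) ?_ ?_
  · have hfx : Continuous (f x) := hfc.comp (Continuous.prodMk_right x)
    exact (hg.continuous_fderiv.comp
      (by fun_prop : Continuous fun p : E × E => ((x, f x p.1), p.2))).continuousAt
  · have := (hd (x, z) (f x z)).comp_hasFDerivAt z (hf.hasFDerivAt x z)
      (.of_forall fun w => (f x w).2)
    simpa only [Function.comp_def, hG] using this

lemma exists_lipschitz [CompactSpace X] (hg : JointC1 g) (z : E) :
    ∃ C, ∀ᶠ w in 𝓝 z, ∀ x, ‖g x w - g x z‖ ≤ C * ‖w - z‖ := by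
  obtain ⟨C, hC⟩ := exists_eventually_forall_norm_le (p := fun w x => fderiv ℝ (g x) w)
    (hg.continuous_fderiv.comp continuous_swap) z
  obtain ⟨δ, hδ, hball⟩ := Metric.eventually_nhds_iff_ball.1 hC
  refine ⟨C, ?_⟩
  filter_upwards [Metric.ball_mem_nhds z hδ] with w hw x
  exact (convex_ball z δ).norm_image_sub_le_of_norm_fderiv_le
    (fun v _ => hg.differentiable x v) (fun v hv => hball v hv x) (Metric.mem_ball_self hδ) hw

section Integral

variable [CompactSpace X] [SecondCountableTopology X] [MeasurableSpace X] [OpensMeasurableSpace X]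
  (ν : Measure X) [IsFiniteMeasure ν]

lemma hasFDerivAt_integral_smul (hg : JointC1 g) {V : X → ℝ} (hV : BddMeasurable V) (z : E) :
    HasFDerivAt (fun w => ∫ x, V x • g x w ∂ν) (∫ x, V x • fderiv ℝ (g x) z ∂ν) z := by
  obtain ⟨C, hC0, hC⟩ := hV.exists_nonneg_bound
  obtain ⟨B, hB⟩ := exists_eventually_forall_norm_le (p := fun w x => fderiv ℝ (g x) w)
    (hg.continuous_fderiv.comp continuous_swap) z
  have hgz : ∀ w, Continuous fun x => g x w := fun w =>
    hg.continuous.comp (Continuous.prodMk_left w)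
  have hmeas : ∀ w, AEStronglyMeasurable (fun x => V x • g x w) ν := fun w =>
    hV.measurable.aestronglyMeasurable.smul (hgz w).aestronglyMeasurable
  refine hasFDerivAt_integral_of_dominated_of_fderiv_le hB (.of_forall hmeas) ?_
    (hV.measurable.aestronglyMeasurable.smul
      (hg.continuous_fderiv.comp (Continuous.prodMk_left z)).aestronglyMeasurable)
    (.of_forall fun x w hw => ?_) (integrable_const (C * B))
    (.of_forall fun x w _ => (hg.hasFDerivAt x w).const_smul (V x))
  · obtain ⟨B', hB'⟩ := isCompact_univ.exists_bound_of_continuousOn (hgz z).continuousOn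
    refine .of_bound (hmeas z) (C * B') (.of_forall fun x => ?_)
    rw [norm_smul]
    exact mul_le_mul (hC x) (hB' x (Set.mem_univ x)) (norm_nonneg _) hC0
  · rw [norm_smul]
    exact mul_le_mul (hC x) (hw x) (norm_nonneg _) hC0

lemma integral_smul [FirstCountableTopology Y] {g : Y × X → E → F} (hg : JointC1 g) {V : X → ℝ}
    (hV : BddMeasurable V) : JointC1 fun y z => ∫ x, V x • g (y, x) z ∂ν :=
  of_hasFDerivAt
    (continuous_integral_smul hV (hg.continuous.comp
      (by fun_prop : Continuous fun w : (Y × E) × X => ((w.1.1, w.2), w.1.2))) ν)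
    (continuous_integral_smul hV (hg.continuous_fderiv.comp
      (by fun_prop : Continuous fun w : (Y × E) × X => ((w.1.1, w.2), w.1.2))) ν)
    fun y z => (hg.comp (Continuous.prodMk_right y)).hasFDerivAt_integral_smul ν hV z

end Integral

section Gradient

variable {E : Type*} [NormedAddCommGroup E] [InnerProductSpace ℝ E] [CompleteSpace E]
  [CompactSpace X] [SecondCountableTopology X] [MeasurableSpace X] [OpensMeasurableSpace X]
  (ν : Measure X) [IsFiniteMeasure ν] {g : X → E → ℝ}

lemma integrable_gradient (hg : JointC1 g) (z : E) :
    Integrable (fun x => gradient (g x) z) ν := by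
  have hc : Continuous fun x => gradient (g x) z :=
    (InnerProductSpace.toDual ℝ E).symm.continuous.comp
      (hg.continuous_fderiv.comp (Continuous.prodMk_left z))
  obtain ⟨C, hC⟩ := isCompact_univ.exists_bound_of_continuousOn hc.continuousOn
  exact .of_bound hc.aestronglyMeasurable C (.of_forall fun x => hC x (Set.mem_univ x))

lemma hasGradientAt_integral (hg : JointC1 g) (z : E) :
    HasGradientAt (fun w => ∫ x, g x w ∂ν) (∫ x, gradient (g x) z ∂ν) z := by
  rw [hasGradientAt_iff_hasFDerivAt, toDual_integral_gradient]
  have hone : BddMeasurable fun _ : X => (1 : ℝ) := .of_continuous continuous_const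
  simpa using hg.hasFDerivAt_integral_smul ν hone z

end Gradient

end JointC1

/-! ### The marginalized integrand -/

lemma Policy.integral_log_dens {S : Type*} [MeasurableSpace S] {m : ℕ} {A : Compacts (Eu m)}
    (π : Policy S A) (s : S) :
    ∫ a, Real.log (π.dens s a) ∂π.kernel s = -π.entropy s := by
  rw [π.integral_kernel, Policy.entropy, neg_neg]

section MixturePolicy

variable {S : Type*} [MeasurableSpace S] {m : ℕ} {A : Compacts (Eu m)} {l : ℕ} {Ξ : Set (Eu l)}
  {d N : ℕ} (P : MixturePolicy S A Ξ d N)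

instance MixturePolicy.isProbabilityMeasure_noiseMeasure :
    IsProbabilityMeasure P.noiseMeasure where
  measure_univ := by
    rw [MixturePolicy.noiseMeasure, withDensity_apply _ MeasurableSet.univ, Measure.restrict_univ]
    exact P.lintegral_noise

lemma MixturePolicy.measurable_comp_apply (θ : Eu d) (s : S) (k : Fin N) :
    Measurable (P.comp θ s k) :=
  (P.measurable_comp θ k).comp measurable_prodMk_left

lemma MixturePolicy.integrable_comp (θ : Eu d) (s : S) (k : Fin N) :
    Integrable (P.comp θ s k) (actionMeasure A) := by
  refine ⟨(P.measurable_comp_apply θ s k).aestronglyMeasurable, ?_⟩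
  rw [hasFiniteIntegral_iff_ofReal (.of_forall (P.comp_nonneg θ s k)), P.lintegral_comp]
  exact ENNReal.one_lt_top

lemma MixturePolicy.aemeasurable_repar (θ : Eu d) (s : S) (k : Fin N) :
    AEMeasurable (P.repar θ s k) P.noiseMeasure := by
  refine AEMeasurable.of_map_ne_zero fun h0 => ?_
  have hmass := congrArg (fun ν => ν Set.univ) ((P.map_repar θ s k).symm.trans h0)
  simp [P.lintegral_comp] at hmass

variable {P}

lemma MixturePolicy.integral_repar {h : A → ℝ} (hh : Measurable h) (θ : Eu d) (s : S) (k : Fin N) :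
    ∫ ε, h (P.repar θ s k ε) ∂P.noiseMeasure
      = ∫ a, P.comp θ s k a * h a ∂actionMeasure A := by
  rw [← integral_map (P.aemeasurable_repar θ s k) hh.aestronglyMeasurable,
    MixturePolicy.noiseMeasure, P.map_repar,
    integral_withDensity_ofReal (P.measurable_comp_apply θ s k) (P.comp_nonneg θ s k)]

lemma MixturePolicy.integral_sum_weight_mul_repar {h : A → ℝ} (hh : BddMeasurable h) (θ : Eu d)
    (s : S) :
    ∫ ε, ∑ k, P.weight θ s k * h (P.repar θ s k ε) ∂P.noiseMeasure
      = ∫ a, h a ∂(P.policy θ).kernel s := by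
  obtain ⟨C, hC⟩ := hh.bdd
  have hrepar : ∀ k, Integrable (fun ε => h (P.repar θ s k ε)) P.noiseMeasure := fun k =>
    .of_bound (hh.measurable.comp_aemeasurable (P.aemeasurable_repar θ s k)).aestronglyMeasurable C
      (.of_forall fun ε => hC (P.repar θ s k ε))
  have hcomp : ∀ k, Integrable (fun a => P.comp θ s k a * h a) (actionMeasure A) := fun k =>
    (P.integrable_comp θ s k).mul_bdd hh.measurable.aestronglyMeasurable (.of_forall hC)
  calc ∫ ε, ∑ k, P.weight θ s k * h (P.repar θ s k ε) ∂P.noiseMeasure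
      = ∑ k, ∫ a, P.weight θ s k * (P.comp θ s k a * h a) ∂actionMeasure A := by
        rw [integral_finsetSum _ fun k _ => (hrepar k).const_mul _]
        simp only [integral_const_mul, MixturePolicy.integral_repar hh.measurable]
    _ = ∫ a, (P.policy θ).dens s a * h a ∂actionMeasure A := by
        rw [← integral_finsetSum _ fun k _ => (hcomp k).const_mul _]
        simp only [MixturePolicy.policy, Finset.sum_mul, mul_assoc]
    _ = ∫ a, h a ∂(P.policy θ).kernel s := ((P.policy θ).integral_kernel s h).symm

lemma integral_mrpIntegrand {μ : Measure S} [IsFiniteMeasure μ] {M : MDP S μ A} {α : ℝ}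
    {θ θ' : Eu d} {s : S} (hr : BddMeasurable fun x : S × A => M.reward x.1 x.2)
    (hH : BddMeasurable (P.policy θ).entropy)
    (hlog : BddMeasurable fun a => Real.log ((P.policy θ').dens s a)) :
    ∫ ε, mrpIntegrand M P α θ s ε θ' ∂P.noiseMeasure
      = M.oneStepValue α (P.policy θ') (P.policy θ) s := by
  have hQ : BddMeasurable fun a => M.softQ α (P.policy θ) s a :=
    (MDP.bddMeasurable_softQ hr hH).comp (φ := fun a => (s, a)) measurable_prodMk_left
  simp only [mrpIntegrand]
  rw [MixturePolicy.integral_sum_weight_mul_repar (hQ.sub (hlog.const_mul α)),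
    integral_sub (hQ.integrable _) ((hlog.const_mul α).integrable _), integral_const_mul,
    Policy.integral_log_dens, MDP.oneStepValue]
  ring

end MixturePolicy

section Regularity

variable {S : Type*} [TopologicalSpace S] [MeasurableSpace S] {μ : Measure S} {m : ℕ}
  {A : Compacts (Eu m)} {l : ℕ} {Ξ : Set (Eu l)} {d N : ℕ} {M : MDP S μ A}
  {P : MixturePolicy S A Ξ d N}

lemma MDP.Regular.bddMeasurable_reward [CompactSpace S] [OpensMeasurableSpace S]
    (hM : M.Regular) : BddMeasurable fun x : S × A => M.reward x.1 x.2 :=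
  .of_continuous hM.continuous_reward

namespace MixturePolicy.Regular

lemma compactSpace_noise [Nonempty S] (hP : P.Regular) : CompactSpace Ξ := by
  obtain ⟨s⟩ := ‹Nonempty S›
  obtain ⟨k, -, -⟩ := Finset.exists_ne_zero_of_sum_ne_zero
    ((P.sum_weight 0 s).trans_ne one_ne_zero)
  have hsymm : Continuous (P.repar 0 s k).symm :=
    (hP.continuous_repar_symm k).comp (by fun_prop : Continuous fun a : A => ((0 : Eu d), s, a))
  refine ⟨?_⟩
  rw [← (P.repar 0 s k).symm.surjective.range_eq]
  exact isCompact_range hsymm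

lemma jointC1_weight (hP : P.Regular) (k : Fin N) : JointC1 fun s θ => P.weight θ s k :=
  (hP.deriv_weight k).jointC1 ((hP.continuous_weight k).comp continuous_swap)

lemma jointC1_comp (hP : P.Regular) (k : Fin N) :
    JointC1 fun (x : S × A) θ => P.comp θ x.1 k x.2 :=
  (hP.deriv_comp_param k).jointC1 ((hP.continuous_comp k).comp continuous_swap)

lemma jointC1_repar (hP : P.Regular) (k : Fin N) :
    JointC1 fun (x : S × Ξ) θ => (P.repar θ x.1 k x.2 : Eu m) :=
  (hP.deriv_repar k).jointC1
    (continuous_subtype_val.comp ((hP.continuous_repar k).comp continuous_swap))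

lemma jointC1_dens (hP : P.Regular) :
    JointC1 fun (x : S × A) θ => (P.policy θ).dens x.1 x.2 :=
  JointC1.sum Finset.univ fun k _ =>
    ((hP.jointC1_weight k).comp continuous_fst).mul (hP.jointC1_comp k)

lemma jointC1_comp_repar (hP : P.Regular) (j k : Fin N) :
    JointC1 fun (x : S × Ξ) θ => P.comp θ x.1 j (P.repar θ x.1 k x.2) :=
  JointC1.comp_action (g := fun (x : S × Ξ) θ a => P.comp θ x.1 j a)
    ((hP.jointC1_comp j).comp (by fun_prop : Continuous fun y : (S × Ξ) × A => (y.1.1, y.2)))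
    ((hP.deriv_comp_action j).comp
      (by fun_prop : Continuous fun y : (S × Ξ) × Eu d => (y.2, y.1.1)))
    (hP.jointC1_repar k)

lemma jointC1_dens_repar (hP : P.Regular) (k : Fin N) :
    JointC1 fun (x : S × Ξ) θ => (P.policy θ).dens x.1 (P.repar θ x.1 k x.2) :=
  JointC1.sum Finset.univ fun j _ =>
    ((hP.jointC1_weight j).comp continuous_fst).mul (hP.jointC1_comp_repar j k)

lemma continuous_dens (hP : P.Regular) (θ : Eu d) :
    Continuous fun x : S × A => (P.policy θ).dens x.1 x.2 :=
  hP.jointC1_dens.continuous.comp (Continuous.prodMk_left θ)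

lemma bddMeasurable_log_dens (hP : P.Regular) {θ : Eu d} {s : S}
    (hpos : ∀ a, 0 < (P.policy θ).dens s a) :
    BddMeasurable fun a => Real.log ((P.policy θ).dens s a) :=
  .of_continuous <| ((hP.continuous_dens θ).comp (Continuous.prodMk_right s)).log
    fun a => (hpos a).ne'

lemma bddMeasurable_entropy [CompactSpace S] [OpensMeasurableSpace S] (hP : P.Regular)
    (θ : Eu d) : BddMeasurable (P.policy θ).entropy := by
  have hmul : BddMeasurable fun x : S × A =>
      (P.policy θ).dens x.1 x.2 * Real.log ((P.policy θ).dens x.1 x.2) :=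
    .of_continuous (Real.continuous_mul_log.comp (hP.continuous_dens θ))
  simpa [Policy.entropy] using!
    (hmul.integral_kernel_prod_right (Kernel.const S (actionMeasure A))).const_mul (-1)

end MixturePolicy.Regular

lemma jointC1_reward_repar (hM : M.Regular) (hP : P.Regular) (k : Fin N) :
    JointC1 fun (x : S × Ξ) θ => M.reward x.1 (P.repar θ x.1 k x.2) :=
  JointC1.comp_action (g := fun (x : S × Ξ) _ a => M.reward x.1 a)
    (.of_const (hM.continuous_reward.comp
      (by fun_prop : Continuous fun y : (S × Ξ) × A => (y.1.1, y.2))))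
    (hM.deriv_reward.comp (by fun_prop : Continuous fun y : (S × Ξ) × Eu d => y.1.1))
    (hP.jointC1_repar k)

lemma jointC1_trans_repar (hM : M.Regular) (hP : P.Regular) (k : Fin N) :
    JointC1 fun (x : (S × Ξ) × S) θ => M.trans x.1.1 (P.repar θ x.1.1 k x.1.2) x.2 :=
  JointC1.comp_action (g := fun (x : (S × Ξ) × S) _ a => M.trans x.1.1 a x.2)
    (.of_const (hM.continuous_trans.comp
      (by fun_prop : Continuous fun y : ((S × Ξ) × S) × A => (y.1.1.1, y.2, y.1.2))))
    (hM.deriv_trans.comp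
      (by fun_prop : Continuous fun y : ((S × Ξ) × S) × Eu d => (y.1.1.1, y.1.2)))
    ((hP.jointC1_repar k).comp continuous_fst)

variable [IsFiniteMeasure μ] [CompactSpace S] [SecondCountableTopology S] [BorelSpace S] {α : ℝ}
  (hM : M.Regular) (hP : P.Regular)
include hM hP

lemma jointC1_softQ_repar (θ : Eu d) (k : Fin N) :
    JointC1 fun (x : S × Ξ) θ' => M.softQ α (P.policy θ) x.1 (P.repar θ' x.1 k x.2) := by
  have hr := hM.bddMeasurable_reward
  have hH := hP.bddMeasurable_entropy θ
  simp only [MDP.softQ_eq_reward_add_softValue hr hH, MDP.integral_transKernel]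
  have hnext := (jointC1_trans_repar hM hP k).integral_smul μ
    (MDP.bddMeasurable_softValue (α := α) hr hH)
  simp only [smul_eq_mul, mul_comm (M.softValue _ _ _)] at hnext
  exact (jointC1_reward_repar hM hP k).add (hnext.const_mul M.disc)

variable (hpos : ∀ θ s a, 0 < (P.policy θ).dens s a)
include hpos

lemma jointC1_mrpIntegrand (θ : Eu d) :
    JointC1 fun (x : S × Ξ) θ' => mrpIntegrand M P α θ x.1 x.2 θ' :=
  JointC1.sum Finset.univ fun k _ => ((hP.jointC1_weight k).comp continuous_fst).mul
    ((jointC1_softQ_repar hM hP θ k).sub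
      (((hP.jointC1_dens_repar k).log fun _ _ => hpos _ _ _).const_mul α))

omit [SecondCountableTopology S] in
lemma oneStepValue_eq_integral_mrpIntegrand (θ θ' : Eu d) (s : S) :
    M.oneStepValue α (P.policy θ') (P.policy θ) s
      = ∫ ε, mrpIntegrand M P α θ s ε θ' ∂P.noiseMeasure :=
  (integral_mrpIntegrand hM.bddMeasurable_reward (hP.bddMeasurable_entropy θ)
    (hP.bddMeasurable_log_dens (hpos θ' s))).symm

variable [CompactSpace Ξ]

lemma bddMeasurable_mrpIntegrand (θ θ' : Eu d) :
    BddMeasurable fun x : S × Ξ => mrpIntegrand M P α θ x.1 x.2 θ' :=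
  .of_continuous ((jointC1_mrpIntegrand hM hP hpos θ).continuous.comp (Continuous.prodMk_left θ'))

lemma integral_oneStepValue_occupancy (θ θ' : Eu d) :
    ∫ s, M.oneStepValue α (P.policy θ') (P.policy θ) s ∂M.occupancy (P.policy θ)
      = ∫ x : S × Ξ, mrpIntegrand M P α θ x.1 x.2 θ'
          ∂((M.occupancy (P.policy θ)).prod P.noiseMeasure) := by
  rw [integral_prod _ ((bddMeasurable_mrpIntegrand hM hP hpos θ θ').integrable _)]
  simp only [oneStepValue_eq_integral_mrpIntegrand hM hP hpos]

lemma exists_abs_oneStepValue_sub_softValue_le (θ : Eu d) :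
    ∃ C, ∀ᶠ θ' in 𝓝 θ, ∀ s,
      |M.oneStepValue α (P.policy θ') (P.policy θ) s - M.softValue α (P.policy θ) s|
        ≤ C * ‖θ' - θ‖ := by
  have hg := jointC1_mrpIntegrand (α := α) hM hP hpos θ
  obtain ⟨C, hC⟩ := hg.exists_lipschitz θ
  have hint : ∀ θ' s, Integrable (fun ε => mrpIntegrand M P α θ s ε θ') P.noiseMeasure :=
    fun θ' s => ((bddMeasurable_mrpIntegrand hM hP hpos θ θ').comp
      (φ := fun ε => (s, ε)) measurable_prodMk_left).integrable _
  refine ⟨C, hC.mono fun θ' hθ' s => ?_⟩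
  rw [MDP.softValue, oneStepValue_eq_integral_mrpIntegrand hM hP hpos,
    oneStepValue_eq_integral_mrpIntegrand hM hP hpos, ← integral_sub (hint θ' s) (hint θ s)]
  exact abs_integral_le_of_abs_le (fun ε => hθ' (s, ε)) _

omit [IsFiniteMeasure μ] [SecondCountableTopology S] [BorelSpace S] [CompactSpace Ξ] hM hpos in
lemma exists_integral_abs_dens_sub_le (θ : Eu d) :
    ∃ D, ∀ᶠ θ' in 𝓝 θ, ∀ s,
      ∫ a, |(P.policy θ').dens s a - (P.policy θ).dens s a| ∂actionMeasure A ≤ D * ‖θ' - θ‖ := by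
  obtain ⟨L, hL⟩ := hP.jointC1_dens.exists_lipschitz θ
  refine ⟨L * (actionMeasure A).real Set.univ, hL.mono fun θ' hθ' s => ?_⟩
  calc ∫ a, |(P.policy θ').dens s a - (P.policy θ).dens s a| ∂actionMeasure A
      ≤ L * ‖θ' - θ‖ * (actionMeasure A).real Set.univ :=
        (le_abs_self _).trans (abs_integral_le_mul_real_univ
          (fun a => (abs_abs _).trans_le (hθ' (s, a))) _)
    _ = L * (actionMeasure A).real Set.univ * ‖θ' - θ‖ := by ring

lemma objective_sub_sub_isBigO (θ : Eu d) :
    (fun θ' => M.objective α (P.policy θ') - M.objective α (P.policy θ)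
      - (∫ x : S × Ξ, mrpIntegrand M P α θ x.1 x.2 θ'
          ∂((M.occupancy (P.policy θ)).prod P.noiseMeasure)
        - ∫ x : S × Ξ, mrpIntegrand M P α θ x.1 x.2 θ
          ∂((M.occupancy (P.policy θ)).prod P.noiseMeasure)))
      =O[𝓝 θ] fun θ' => ‖θ' - θ‖ ^ 2 := by
  have hr := hM.bddMeasurable_reward
  have hH := hP.bddMeasurable_entropy
  have hB : ∀ θ', Integrable (M.oneStepValue α (P.policy θ') (P.policy θ))
      (M.occupancy (P.policy θ)) := fun θ' =>
    (MDP.bddMeasurable_oneStepValue hr (hH θ) (hH θ')).integrable _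
  obtain ⟨C, hC⟩ := exists_abs_oneStepValue_sub_softValue_le (α := α) hM hP hpos θ
  obtain ⟨D, hD⟩ := exists_integral_abs_dens_sub_le hP θ
  refine .of_bound (M.disc * (C / (1 - M.disc) * D) * (M.occupancy (P.policy θ)).real Set.univ) ?_
  filter_upwards [hC, hD] with θ' hCθ' hDθ'
  rw [← integral_oneStepValue_occupancy hM hP hpos, ← integral_oneStepValue_occupancy hM hP hpos,
    ← integral_sub (hB θ') (hB θ), Real.norm_eq_abs, Real.norm_of_nonneg (sq_nonneg _)]
  refine (MDP.abs_objective_sub_le hr (hH θ) (hH θ') hCθ' hDθ').trans_eq ?_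
  ring

end Regularity

end MixturePG

end

open MixturePG in
/-- Entropy-regularized marginalized-reparameterization policy gradient theorem. -/
theorem mainTheorem1
    {S : Type*} [TopologicalSpace S] [CompactSpace S] [SecondCountableTopology S]
    [MeasurableSpace S] [BorelSpace S] (μ : Measure S) [IsFiniteMeasure μ]
    {m : ℕ} (A : Compacts (Eu m)) {l : ℕ} (Ξ : Set (Eu l)) {d N : ℕ}
    (M : MDP S μ A) (P : MixturePolicy S A Ξ d N) (α : ℝ)
    (hM : M.Regular) (hP : P.Regular)
    (hpos : ∀ θ s a, 0 < (P.policy θ).dens s a)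
    (θ : Eu d) :
    (∀ s ε, DifferentiableAt ℝ (mrpIntegrand M P α θ s ε) θ) ∧
    Integrable (fun x : S × Ξ => gradient (mrpIntegrand M P α θ x.1 x.2) θ)
      ((M.occupancy (P.policy θ)).prod P.noiseMeasure) ∧
    HasGradientAt (fun θ' => M.objective α (P.policy θ'))
      (∫ x : S × Ξ, gradient (mrpIntegrand M P α θ x.1 x.2) θ
        ∂((M.occupancy (P.policy θ)).prod P.noiseMeasure)) θ := by
  have : Nonempty S := M.initMeasure.nonempty_of_neZero
  have := hP.compactSpace_noise
  have hg := jointC1_mrpIntegrand (α := α) hM hP hpos θ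
  exact ⟨fun s ε => hg.differentiable (s, ε) θ, hg.integrable_gradient _ θ,
    hasGradientAt_of_isBigO_sub_sub (hg.hasGradientAt_integral _ θ)
      (objective_sub_sub_isBigO hM hP hpos θ)⟩
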